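/- All graphs are finite and simple. A graph $G$ is $k$-connected if $|V(G)|>k$ and $G-S$ is connected for every $S\subseteq V(G)$ with $|S|<k$; $\alpha(G)$ denotes the maximum size of an independent set of $G$. A path in $G$ is a longest path if no path in $G$ has more edges, and a vertex is a Gallai vertex of $G$ if it lies on every longest path in $G$. Theorem. For each positive integer $k$ there is an integer $n_0$ such that in every $k$-connected graph $G$ with $\alpha(G)\le k+2$ and at least $n_0$ vertices, each vertex of maximum degree is a Gallai vertex, i.e. lies on every longest path of $G$. Explicitly, this holds with $n_0=k(k+2)(2k+3)+1$. -/

import Mathlib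

namespace SimpleGraph

/-- A finite graph is `k`-connected if it has more than `k` vertices and `G - S` is connected for
each set `S` of fewer than `k` vertices. -/
def IsKVertexConnected {V : Type*} [Fintype V] (G : SimpleGraph V) (k : ℕ) : Prop :=
  k < Fintype.card V ∧ ∀ S : Finset V, S.card < k → (G.induce ((S : Set V)ᶜ)).Connected

/-- A path of `G` is longest if no path of `G`, with whatever endpoints, has more edges. -/
def Walk.IsLongestPath {V : Type*} {G : SimpleGraph V} {x y : V} (P : G.Walk x y) : Prop :=
  P.IsPath ∧ ∀ (a b : V) (Q : G.Walk a b), Q.IsPath → Q.length ≤ P.length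

/-- A Gallai set (longest path transversal): every longest path of `G` has a vertex in `S`. -/
def IsGallaiSet {V : Type*} (G : SimpleGraph V) (S : Set V) : Prop :=
  ∀ (x y : V) (P : G.Walk x y), P.IsLongestPath → ∃ v ∈ S, v ∈ P.support

/-- A vertex `v` is a Gallai vertex if `{v}` is a Gallai set, i.e. if `v` lies on every longest
path. -/
def IsGallaiVertex {V : Type*} (G : SimpleGraph V) (v : V) : Prop :=
  G.IsGallaiSet {v}

end SimpleGraph

/-!
Let `v` be a vertex of maximum degree that is missed by a longest path. The proof works in the cone
over `G`, where a longest path becomes a longest cycle `P` through the apex `w`. This puts the ends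
of the path on the same footing as its inner vertices. With `K = k + 1`, separators of the cone have
at least `K` elements (`IsKVertexConnected.separatorsAtLeast_cone`), and independent sets at most
`K + 1` (`card_le_of_isIndepSet_cone`).

Let `C` be the component of `v` off `P`, and `U` its set of neighbours on `P`. The set `U` cuts `P`
into segments. Everything rests on one exchange (`IsLongestCycleThrough.exchange`): an edge between
two segments lets the cycle make a detour through `C`, at the cost of the parts of the two segments
that are left out. The argument of Chvátal and Erdős shows that the first vertices of the segments
and a vertex of `C` are independent. So `|U| = K`, this set is a maximum independent set, and `C` is
a clique. Now `v` has degree less than `|C| + K`, and no vertex other than `w` has larger degree.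
Counting the neighbours of the first vertices of the segments shows that `C` is large
(`card_le`), whereas each segment has at least `|C|` vertices and all segments together have at most
`K * (K - 1)` more than `K * |C|` (`sum_length_le`).

Exchanges gaining `|C|` vertices then show that the first `|C|` vertices of a segment form a clique,
and so do the last `|C|`. The vertices in the middle of a segment can be reached from both of its
ends on long routes, and hence have no neighbours in other segments (`not_adj_middle`). Since
independent sets are small, each segment is a clique (`adj_of_mem_seg`), and all vertices lie on `P`
or in `C` (`mem_of_notMem_cycle`). The only possible edges between segments join the end of one to
the start of another, and they force the segments to be longer than `|C|` and the adjacent members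
of `U` to have just one neighbour in them (`of_segLast_adj_segFirst`). Together with the bound on
separators this gives every member of `U` a neighbour in each segment (`exists_adj_seg`). By the
bound on independent sets, a member of `U` is adjacent to all of `C` or to almost all of some
segment. So the degree of any member other than `w` is at least `|C| + K` (`le_card_neighbors`),
more than that of `v`.
-/

namespace SimpleGraph

variable {W : Type*}

/-! ### Closed chains -/

/-- A list of vertices whose consecutive members are adjacent, cyclically: the last one is adjacent
to the first. A list `[a, b]` with `a` adjacent to `b` counts. -/
def IsClosedChain (H : SimpleGraph W) (l : List W) : Prop :=
  l.IsChain H.Adj ∧ ∀ a ∈ l.getLast?, ∀ b ∈ l.head?, H.Adj a b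

lemma IsClosedChain.append_comm {H : SimpleGraph W} {l₁ l₂ : List W}
    (h : H.IsClosedChain (l₁ ++ l₂)) : H.IsClosedChain (l₂ ++ l₁) := by
  rcases l₁ with _ | ⟨a, l₁⟩
  · simpa using h
  rcases l₂ with _ | ⟨b, l₂⟩
  · simpa using h
  unfold IsClosedChain at *
  rw [List.isChain_append] at *
  simp only [List.getLast?_append, List.head?_append, List.head?_cons, Option.some_or,
    List.getLast?_cons, Option.mem_def, Option.some.injEq, forall_eq'] at *
  tauto

lemma IsClosedChain.of_isRotated {H : SimpleGraph W} {l₁ l₂ : List W} (h : H.IsClosedChain l₁)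
    (hr : l₁ ~r l₂) : H.IsClosedChain l₂ := by
  obtain ⟨n, hn, rfl⟩ := List.isRotated_iff_mod.1 hr
  rw [List.rotate_eq_drop_append_take hn]
  exact IsClosedChain.append_comm (by simpa using h)

/-- A longest cycle through `w`, as a list of its vertices in cyclic order. A single edge, traversed
back and forth, counts as a cycle. -/
structure IsLongestCycleThrough (H : SimpleGraph W) (w : W) (P : List W) : Prop where
  mem : w ∈ P
  nodup : P.Nodup
  closed : H.IsClosedChain P
  max : ∀ Q : List W, w ∈ Q → Q.Nodup → H.IsClosedChain Q → Q.length ≤ P.length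

lemma IsLongestCycleThrough.of_isRotated {H : SimpleGraph W} {w : W} {P Q : List W}
    (h : H.IsLongestCycleThrough w P) (hr : P ~r Q) : H.IsLongestCycleThrough w Q where
  mem := hr.mem_iff.1 h.mem
  nodup := hr.nodup_iff.1 h.nodup
  closed := h.closed.of_isRotated hr
  max R h₁ h₂ h₃ := (h.max R h₁ h₂ h₃).trans hr.perm.length_eq.le

lemma IsLongestCycleThrough.reverse {H : SimpleGraph W} {w : W} {P : List W}
    (h : H.IsLongestCycleThrough w P) : H.IsLongestCycleThrough w P.reverse where
  mem := List.mem_reverse.2 h.mem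
  nodup := List.nodup_reverse.2 h.nodup
  closed := by
    refine ⟨?_, fun a ha b hb => (h.closed.2 b ?_ a ?_).symm⟩
    · rw [List.isChain_reverse]
      exact h.closed.1.imp fun _ _ h => h.symm
    · rwa [List.head?_reverse] at hb
    · rwa [List.getLast?_reverse] at ha
  max Q h₁ h₂ h₃ := (h.max Q h₁ h₂ h₃).trans (by simp)

/-! ### Routes -/

/-- There is a path from `p` to `q` inside `S` with at least `ℓ` vertices, given as the list of its
vertices. -/
def HasRoute (H : SimpleGraph W) (S : Set W) (ℓ : ℕ) (p q : W) : Prop :=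
  ∃ L : List W, L.Nodup ∧ L.IsChain H.Adj ∧ L.head? = some p ∧ L.getLast? = some q ∧
    (∀ x ∈ L, x ∈ S) ∧ ℓ ≤ L.length

lemma HasRoute.symm {H : SimpleGraph W} {S : Set W} {ℓ : ℕ} {p q : W} (h : H.HasRoute S ℓ p q) :
    H.HasRoute S ℓ q p := by
  obtain ⟨L, h₁, h₂, h₃, h₄, h₅, h₆⟩ := h
  refine ⟨L.reverse, by simpa, ?_, by simpa, by simpa, by simpa, by simpa⟩
  rw [List.isChain_reverse]
  exact h₂.imp fun _ _ h => h.symm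

lemma HasRoute.mono {H : SimpleGraph W} {S T : Set W} {ℓ m : ℕ} {p q : W}
    (h : H.HasRoute S ℓ p q) (hST : S ⊆ T) (hm : m ≤ ℓ) : H.HasRoute T m p q := by
  obtain ⟨L, h₁, h₂, h₃, h₄, h₅, h₆⟩ := h
  exact ⟨L, h₁, h₂, h₃, h₄, fun x hx => hST (h₅ x hx), hm.trans h₆⟩

lemma hasRoute_singleton {H : SimpleGraph W} {S : Set W} {p : W} (h : p ∈ S) :
    H.HasRoute S 1 p p :=
  ⟨[p], by simp, by simp, by simp, by simp, by simpa, by simp⟩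

/-- A clique contains a Hamiltonian path between any two of its vertices. -/
lemma IsClique.hasRoute [DecidableEq W] {H : SimpleGraph W} {S : Finset W}
    (hS : H.IsClique (S : Set W)) {p q : W} (hp : p ∈ S) (hq : q ∈ S) (hpq : p ≠ q) :
    H.HasRoute (S : Set W) S.card p q := by
  have hnd : (p :: (((S.erase p).erase q).toList ++ [q])).Nodup := by
    simp [List.nodup_append, Finset.nodup_toList, hpq]
    grind
  have hmem : ∀ x ∈ p :: (((S.erase p).erase q).toList ++ [q]), x ∈ S := by
    simp
    grind
  refine ⟨p :: (((S.erase p).erase q).toList ++ [q]), hnd, ?_, by simp, ?_, by simpa using hmem, ?_⟩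
  · refine List.Pairwise.isChain (List.Pairwise.imp_of_mem ?_ hnd)
    intro a b ha hb hab
    exact hS (hmem a ha) (hmem b hb) hab
  · simp [List.getLast?_cons]
  · have h₁ : q ∈ S.erase p := Finset.mem_erase.2 ⟨hpq.symm, hq⟩
    have h₂ := Finset.card_erase_add_one h₁
    have h₃ := Finset.card_erase_add_one hp
    simp
    omega

/-! ### Exchanges on a longest cycle -/

/-- A part of a longest cycle is at least as long as any detour around it. -/
lemma IsLongestCycleThrough.le_of_bypass {H : SimpleGraph W} {w : W} {P I Z : List W}
    (hP : H.IsLongestCycleThrough w P) (hr : P ~r I ++ Z) (hw : w ∉ I) {z₁ z₂ p q : W}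
    (hz₁ : Z.head? = some z₁) (hz₂ : Z.getLast? = some z₂) {S : Set W} {ℓ : ℕ}
    (hS : ∀ x ∈ S, x ∉ Z) (hD : H.HasRoute S ℓ p q) (hp : H.Adj z₂ p) (hq : H.Adj q z₁) :
    ℓ ≤ I.length := by
  obtain ⟨D, hnd, hch, hhd, hlast, hDS, hℓ⟩ := hD
  have hP' := hP.of_isRotated hr
  have h₁ := hP'.closed.1
  have h₂ := hP'.nodup
  have hwZ : w ∈ Z := by simpa [hw] using hP'.mem
  rw [List.isChain_append] at h₁
  have h := hP'.max (D ++ Z) (by simp [hwZ]) ?_ ⟨?_, ?_⟩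
  · simp at h
    omega
  · rw [List.nodup_append] at *
    exact ⟨hnd, h₂.2.1, fun a ha b hb hab => hS a (hDS a ha) (hab ▸ hb)⟩
  · rw [List.isChain_append]
    refine ⟨hch, h₁.2.1, ?_⟩
    simp [hlast, hz₁, hq]
  · simp [List.getLast?_append, List.head?_append, hhd, hz₂, hp]

/-- The basic exchange: an edge `ab` between the parts `I` and `J` of a longest cycle
`I ++ Y ++ J ++ Z`, together with a route through vertices off the cycle that joins the last
vertices of `Y` and `Z`, gives a cycle that runs through `Y` backwards. It contains only a route
from the end of `I` to `a` and a route from `b` to the end of `J`, and misses the rest of these two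
parts. -/
lemma IsLongestCycleThrough.exchange {H : SimpleGraph W} {w : W} {P I Y J Z : List W}
    (hP : H.IsLongestCycleThrough w P) (hr : P ~r I ++ (Y ++ (J ++ Z))) (hwI : w ∉ I) (hwJ : w ∉ J)
    {y₁ y₂ z₁ z₂ : W} (hy₁ : Y.head? = some y₁) (hy₂ : Y.getLast? = some y₂)
    (hz₁ : Z.head? = some z₁) (hz₂ : Z.getLast? = some z₂) {S : Set W} (hS : ∀ x ∈ S, x ∉ P)
    {ℓ m n : ℕ} {p a b q d d' : W}
    (hI : H.HasRoute {x | x ∈ I} m p a) (hJ : H.HasRoute {x | x ∈ J} n b q)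
    (hD : H.HasRoute S ℓ d d') (h₁ : H.Adj y₁ p) (h₂ : H.Adj a b) (h₃ : H.Adj q z₁)
    (h₄ : H.Adj z₂ d) (h₅ : H.Adj d' y₂) :
    m + n + ℓ ≤ I.length + J.length := by
  obtain ⟨D, hDnd, hDch, hDhd, hDlast, hDS, hℓ⟩ := hD
  obtain ⟨I', hInd, hIch, hIhd, hIlast, hIS, hm⟩ := hI
  obtain ⟨J', hJnd, hJch, hJhd, hJlast, hJS, hn⟩ := hJ
  have hP' := hP.of_isRotated hr
  have hc := hP'.closed.1
  have hnd := hP'.nodup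
  have hwYZ : w ∈ Y ∨ w ∈ Z := by simpa [hwI, hwJ] using hP'.mem
  have hmem : ∀ x, x ∈ P ↔ x ∈ I ∨ x ∈ Y ∨ x ∈ J ∨ x ∈ Z := fun x => by simp [hr.mem_iff]
  simp only [List.isChain_append] at hc
  have h := hP'.max (I' ++ (J' ++ (Z ++ (D ++ Y.reverse)))) (by simp; tauto) ?_ ⟨?_, ?_⟩
  · simp at h
    omega
  · simp only [List.nodup_append, List.mem_append] at hnd ⊢
    simp only [List.nodup_reverse, List.mem_reverse]
    simp only [Set.mem_ofPred_eq] at hIS hJS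
    refine ⟨hInd, ⟨hJnd, ⟨by tauto, ⟨hDnd, by tauto, ?_⟩, ?_⟩, ?_⟩, ?_⟩ <;> grind
  · have hYr : Y.reverse.IsChain H.Adj := by
      rw [List.isChain_reverse]
      exact hc.2.1.1.imp fun _ _ h => h.symm
    simp only [List.isChain_append]
    refine ⟨hIch, ⟨hJch, ⟨hc.2.1.2.1.2.1, ⟨hDch, hYr, ?_⟩, ?_⟩, ?_⟩, ?_⟩ <;>
      simp_all [List.head?_append]
  · simp_all [List.getLast?_append, List.head?_append]

lemma isRotated_cons_inj {u : W} {A B : List W} (h : (u :: A) ~r (u :: B))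
    (hnd : (u :: A).Nodup) : A = B := by
  obtain ⟨n, hn, h⟩ := List.isRotated_iff_mod.1 h
  rcases hn.eq_or_lt with hn | hn
  · subst hn
    rw [List.rotate_length] at h
    exact (List.cons.inj h).2
  · rcases Nat.eq_zero_or_pos n with rfl | hpos
    · simpa using h
    · rw [List.rotate_eq_drop_append_take hn.le] at h
      have h0 := congrArg List.head? h
      rw [List.head?_append, List.head?_drop] at h0
      simp [List.getElem?_eq_getElem hn] at h0
      have := (List.Nodup.getElem_inj_iff hnd (hi := hn) (hj := by simp)).1
        (h0.trans (by simp : u = (u :: A)[0]))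
      omega

/-- The vertices of `U` cut a cyclic list into segments: `I u` is the one that follows `u ∈ U`, and
`nx u` is the member of `U` at which it ends. -/
lemma exists_segments [DecidableEq W] {P : List W} (hP : P.Nodup) {U : Finset W}
    (hU : ∀ u ∈ U, u ∈ P) (hne : ∃ u ∈ U, ∃ u' ∈ U, u ≠ u') :
    ∃ (I : W → List W) (nx : W → W), (∀ u ∈ U, nx u ∈ U) ∧ (∀ u ∈ U, ∀ z ∈ I u, z ∉ U) ∧
      (∀ z ∈ P, z ∉ U → ∃ u ∈ U, z ∈ I u) ∧
      ∀ u ∈ U, ∀ u' ∈ U, u ≠ u' → ∃ Y Z : List W, P ~r I u ++ (Y ++ (I u' ++ Z)) ∧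
        Y.head? = some (nx u) ∧ Y.getLast? = some u' ∧
        Z.head? = some (nx u') ∧ Z.getLast? = some u := by
  have hrot : ∀ u ∈ P, ∃ R, P ~r u :: R := by
    intro u hu
    obtain ⟨A, B, rfl⟩ := List.append_of_mem hu
    exact ⟨B ++ A, by simpa using List.isRotated_append (l := A) (l' := u :: B)⟩
  have hrot' : ∀ u, ∃ R, u ∈ U → P ~r u :: R := fun u => by
    by_cases h : u ∈ U
    · obtain ⟨R, hR⟩ := hrot u (hU u h)
      exact ⟨R, fun _ => hR⟩
    · exact ⟨[], fun h' => absurd h' h⟩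
  -- `R u` lists the vertices other than `u` in the order in which they follow `u`.
  choose R hR using hrot'
  have huniq : ∀ u ∈ U, ∀ B, P ~r u :: B → R u = B := fun u hu B hB =>
    isRotated_cons_inj ((hR u hu).symm.trans hB) ((hR u hu).nodup_iff.1 hP)
  set f : W → Bool := fun z => decide (z ∉ U) with hf
  have hdrop : ∀ u ∈ U, ∃ z ∈ U, ((R u).dropWhile f).head? = some z := by
    intro u hu
    have : ∃ u' ∈ U, u' ∈ R u := by
      obtain ⟨a, ha, b, hb, hab⟩ := hne
      have h₁ := (hR u hu).mem_iff.1 (hU a ha)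
      have h₂ := (hR u hu).mem_iff.1 (hU b hb)
      simp only [List.mem_cons] at h₁ h₂
      grind
    obtain ⟨u', hu', hmem⟩ := this
    rcases h : (R u).dropWhile f with _ | ⟨z, T⟩
    · rw [List.dropWhile_eq_nil_iff] at h
      simpa [hf, hu'] using h u' hmem
    · refine ⟨z, ?_, by simp⟩
      have := List.head_dropWhile_not f (l := R u) (by simp [h])
      simp only [h, List.head_cons] at this
      simpa [hf] using this
  refine ⟨fun u => (R u).takeWhile f, fun u => (((R u).dropWhile f).head?).getD u, ?_, ?_, ?_, ?_⟩
  · intro u hu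
    obtain ⟨z, hz, h⟩ := hdrop u hu
    simpa [h]
  · intro u hu z hz
    simpa [hf] using List.mem_takeWhile_imp hz
  · intro z hz hzU
    obtain ⟨R', hR'⟩ := hrot z hz
    have : ∃ u ∈ U, u ∈ R' := by
      obtain ⟨a, ha, -⟩ := hne
      have h₁ := hR'.mem_iff.1 (hU a ha)
      simp only [List.mem_cons] at h₁
      grind
    obtain ⟨u₀, hu₀, hmem⟩ := this
    -- The last member of `U` in `R'`, that is, the one that precedes `z` on the cycle.
    rcases h : R'.reverse.dropWhile f with _ | ⟨u, T⟩
    · rw [List.dropWhile_eq_nil_iff] at h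
      simpa [hf, hu₀] using h u₀ (by simpa)
    have hu : u ∈ U := by
      have := List.head_dropWhile_not f (l := R'.reverse) (by simp [h])
      simp only [h, List.head_cons] at this
      simpa [hf] using this
    set B := R'.reverse.takeWhile f with hB
    have hR'' : R' = T.reverse ++ u :: B.reverse := by
      have := List.takeWhile_append_dropWhile (p := f) (l := R'.reverse)
      rw [h, ← hB] at this
      rw [← List.reverse_reverse R', ← this]
      simp
    refine ⟨u, hu, ?_⟩
    have hRu : R u = B.reverse ++ z :: T.reverse := by
      refine huniq u hu _ (hR'.trans ?_)
      rw [hR'']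
      have := List.isRotated_append (l := z :: T.reverse) (l' := u :: B.reverse)
      simpa using this
    change z ∈ (R u).takeWhile f
    rw [hRu, List.takeWhile_append_of_pos, List.takeWhile_cons_of_pos]
    · simp
    · simpa [hf]
    · intro x hx
      exact List.mem_takeWhile_imp (List.mem_reverse.1 hx)
  · intro u hu u' hu' huu'
    have hR₁ := List.takeWhile_append_dropWhile (p := f) (l := R u)
    have hmem : u' ∈ (R u).dropWhile f := by
      have h₁ : u' ∈ R u := by
        have := (hR u hu).mem_iff.1 (hU u' hu')
        simp only [List.mem_cons] at this
        grind
      rw [← hR₁, List.mem_append] at h₁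
      refine h₁.resolve_left fun h => ?_
      have := List.mem_takeWhile_imp h
      simp [hf, hu'] at this
    obtain ⟨Y, T, hT⟩ := List.append_of_mem hmem
    -- `R u'` passes `u ∈ U` right after `T`, so `T ++ [u]` alone determines the segment of `u'`.
    have hRu' : R u' = (T ++ [u]) ++ ((R u).takeWhile f ++ Y) := by
      refine huniq u' hu' _ ((hR u hu).trans ?_)
      have := List.isRotated_append (l := u :: ((R u).takeWhile f ++ Y)) (l' := u' :: T)
      have hRu : R u = (R u).takeWhile f ++ (Y ++ u' :: T) := by rw [← hT, hR₁]
      nth_rw 1 [hRu]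
      simpa using this
    have hTu : (T ++ [u]).takeWhile f ≠ T ++ [u] := by
      intro h
      have := List.mem_takeWhile_imp (p := f) (l := T ++ [u]) (x := u) (by rw [h]; simp)
      simp [hf, hu] at this
    have hlen : ((T ++ [u]).takeWhile f).length ≠ (T ++ [u]).length := fun h =>
      hTu ((List.takeWhile_prefix f).eq_of_length h)
    have htake : (R u').takeWhile f = (T ++ [u]).takeWhile f := by
      rw [hRu', List.takeWhile_append, if_neg hlen]
    have hne' : (T ++ [u]).dropWhile f ≠ [] := by
      intro h
      rw [List.dropWhile_eq_nil_iff] at h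
      simpa [hf, hu] using h u (by simp)
    have hsplit := List.takeWhile_append_dropWhile (p := f) (l := T ++ [u])
    have hdropu' : (R u').dropWhile f = (T ++ [u]).dropWhile f ++ ((R u).takeWhile f ++ Y) := by
      have := List.takeWhile_append_dropWhile (p := f) (l := R u')
      rw [htake] at this
      refine List.append_cancel_left (as := (T ++ [u]).takeWhile f) (this.trans ?_)
      rw [← List.append_assoc, hsplit, hRu']
    refine ⟨Y ++ [u'], (T ++ [u]).dropWhile f, ?_, ?_, by simp, ?_, ?_⟩
    · change P ~r (R u).takeWhile f ++ (_ ++ ((R u').takeWhile f ++ _))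
      rw [htake, hsplit]
      refine (hR u hu).trans ?_
      have := List.isRotated_append (l := [u]) (l' := (R u).takeWhile f ++ (Y ++ u' :: T))
      have hRu : R u = (R u).takeWhile f ++ (Y ++ u' :: T) := by rw [← hT, hR₁]
      rw [← hRu] at this
      nth_rw 2 [hRu] at this
      simpa using this
    · obtain ⟨z, hz, h⟩ := hdrop u hu
      change _ = some ((((R u).dropWhile f).head?).getD u)
      rw [h, Option.getD_some, ← h, hT]
      cases Y <;> simp
    · obtain ⟨z, hz, h⟩ := hdrop u' hu'
      change _ = some ((((R u').dropWhile f).head?).getD u')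
      rw [h, Option.getD_some, ← h, hdropu', List.head?_append]
      rw [List.head?_eq_some_head hne']
      simp
    · have := congrArg List.getLast? hsplit
      rw [List.getLast?_append, List.getLast?_eq_some_getLast hne'] at this
      rw [List.getLast?_eq_some_getLast hne']
      simpa using this

/-! ### Segments of a longest cycle -/

/-- A longest cycle `P` through `w`, a set `C` of vertices off `P`, and a set `U` of vertices of `P`
that contains all neighbours of `C` outside `C`. The members of `U` cut `P` into segments: `I u`
lists the vertices strictly between `u ∈ U` and the next member `nx u` of `U`. For distinct
`u, u' ∈ U` the cycle reads `I u, Y, I u', Z`, where `Y` runs from `nx u` to `u'` and `Z` from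
`nx u'` to `u`. -/
structure IsCycleFrame (H : SimpleGraph W) (w : W) (P : List W) (C U : Finset W)
    (I : W → List W) (nx : W → W) : Prop where
  longest : H.IsLongestCycleThrough w P
  apex_mem : w ∈ U
  mem_cycle : ∀ u ∈ U, u ∈ P
  notMem_cycle : ∀ x ∈ C, x ∉ P
  attach : ∀ x ∈ C, ∀ y, H.Adj x y → y ∈ C ∨ y ∈ U
  two : ∃ u ∈ U, ∃ u' ∈ U, u ≠ u'
  nx_mem : ∀ u ∈ U, nx u ∈ U
  notMem_of_mem_seg : ∀ u ∈ U, ∀ z ∈ I u, z ∉ U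
  exists_mem_seg : ∀ z ∈ P, z ∉ U → ∃ u ∈ U, z ∈ I u
  decomp : ∀ u ∈ U, ∀ u' ∈ U, u ≠ u' → ∃ Y Z : List W, P ~r I u ++ (Y ++ (I u' ++ Z)) ∧
    Y.head? = some (nx u) ∧ Y.getLast? = some u' ∧ Z.head? = some (nx u') ∧ Z.getLast? = some u

/-- Any two vertices of `U` are joined by a path with at least `ℓ` inner vertices, all in `C`. -/
def IsLinked (H : SimpleGraph W) (C U : Finset W) (ℓ : ℕ) : Prop :=
  ∀ u ∈ U, ∀ u' ∈ U, u ≠ u' → ∃ d d', H.Adj u d ∧ H.Adj d' u' ∧ H.HasRoute (C : Set W) ℓ d d'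

/-- The first vertex of the segment of `u` (and `u` itself if the segment is empty). -/
def segFirst (I : W → List W) (u : W) : W := ((I u).head?).getD u

/-- The last vertex of the segment of `u` (and `u` itself if the segment is empty). -/
def segLast (I : W → List W) (u : W) : W := ((I u).getLast?).getD u

lemma head?_eq_segFirst {I : W → List W} {u : W} (h : I u ≠ []) :
    (I u).head? = some (segFirst I u) := by
  simp [segFirst, List.head?_eq_some_head h]

lemma getLast?_eq_segLast {I : W → List W} {u : W} (h : I u ≠ []) :
    (I u).getLast? = some (segLast I u) := by
  simp [segLast, List.getLast?_eq_some_getLast h]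

lemma segFirst_mem {I : W → List W} {u : W} (h : I u ≠ []) : segFirst I u ∈ I u :=
  List.mem_of_mem_head? (head?_eq_segFirst h)

lemma segLast_mem {I : W → List W} {u : W} (h : I u ≠ []) : segLast I u ∈ I u :=
  List.mem_of_mem_getLast? (getLast?_eq_segLast h)

lemma segFirst_ne_segLast {I : W → List W} {u : W} (hnd : (I u).Nodup) (h : 2 ≤ (I u).length) :
    segFirst I u ≠ segLast I u := by
  rcases hI : I u with _ | ⟨a, _ | ⟨b, l⟩⟩
  · simp [hI] at h
  · simp [hI] at h
  · rw [hI] at hnd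
    intro heq
    have h₁ : (b :: l).getLast? = some (segLast I u) := by
      simp [segLast, hI, List.getLast?_eq_some_getLast]
    have h₂ := List.mem_of_mem_getLast? h₁
    have h₃ : segFirst I u = a := by simp [segFirst, hI]
    rw [← heq, h₃] at h₂
    exact (List.nodup_cons.1 hnd).1 h₂

/-- A vertex among the first `c` of a path starts a subpath that reaches the end and misses fewer
than `c` vertices. -/
lemma hasRoute_of_mem_take {H : SimpleGraph W} {l : List W} (hnd : l.Nodup)
    (hch : l.IsChain H.Adj) {c : ℕ} {a t : W} (ha : a ∈ l.take c) (ht : l.getLast? = some t) :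
    H.HasRoute {x | x ∈ l} (l.length + 1 - c) a t := by
  obtain ⟨A, B, hAB⟩ := List.append_of_mem ha
  have hl : l = A ++ (a :: (B ++ l.drop c)) := by
    have := List.take_append_drop c l
    rw [hAB] at this
    simpa using this.symm
  have hA : A.length < c := by
    have := congrArg List.length hAB
    simp at this
    omega
  have hlen := congrArg List.length hl
  rw [hl] at hnd hch ht
  refine ⟨a :: (B ++ l.drop c), (List.nodup_append.1 hnd).2.1, (List.isChain_append.1 hch).2.1,
    by simp, ?_, ?_, ?_⟩
  · rw [List.getLast?_append, List.getLast?_eq_some_getLast (List.cons_ne_nil _ _)] at ht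
    rw [List.getLast?_eq_some_getLast (List.cons_ne_nil _ _)]
    simpa using ht
  · intro x hx
    rw [hl]
    exact List.mem_append_right _ hx
  · rw [List.length_append] at hlen
    omega

namespace IsCycleFrame

variable {H : SimpleGraph W} {w : W} {P : List W} {C U : Finset W} {I : W → List W} {nx : W → W}

lemma exists_ne (F : H.IsCycleFrame w P C U I nx) {u : W} : ∃ u' ∈ U, u ≠ u' := by
  obtain ⟨a, ha, b, hb, hab⟩ := F.two
  by_cases h : u = a
  · exact ⟨b, hb, h ▸ hab⟩
  · exact ⟨a, ha, h⟩

lemma notMem_seg (F : H.IsCycleFrame w P C U I nx) {u : W} (hu : u ∈ U) {v : W} (hv : v ∈ U) :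
    v ∉ I u :=
  fun h => F.notMem_of_mem_seg u hu v h hv

lemma mem_cycle_of_mem_seg (F : H.IsCycleFrame w P C U I nx) {u : W} (hu : u ∈ U) {z : W}
    (hz : z ∈ I u) : z ∈ P := by
  obtain ⟨u', hu', hne⟩ := F.exists_ne (u := u)
  obtain ⟨Y, Z, hr, -⟩ := F.decomp u hu u' hu' hne
  exact hr.mem_iff.2 (List.mem_append_left _ hz)

lemma nx_ne (F : H.IsCycleFrame w P C U I nx) {u : W} (hu : u ∈ U) : nx u ≠ u := by
  obtain ⟨u', hu', hne⟩ := F.exists_ne (u := u)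
  obtain ⟨Y, Z, hr, h₁, -, -, h₂⟩ := F.decomp u hu u' hu' hne
  have hnd := hr.nodup_iff.1 F.longest.nodup
  intro h
  rw [h] at h₁
  have := List.mem_of_mem_head? h₁
  have := List.mem_of_mem_getLast? h₂
  simp only [List.nodup_append, List.mem_append] at hnd
  grind

lemma nx_ne_nx (F : H.IsCycleFrame w P C U I nx) {u u' : W} (hu : u ∈ U) (hu' : u' ∈ U)
    (hne : u ≠ u') : nx u ≠ nx u' := by
  obtain ⟨Y, Z, hr, h₁, -, h₂, -⟩ := F.decomp u hu u' hu' hne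
  have hnd := hr.nodup_iff.1 F.longest.nodup
  intro h
  rw [h] at h₁
  have := List.mem_of_mem_head? h₁
  have := List.mem_of_mem_head? h₂
  simp only [List.nodup_append, List.mem_append] at hnd
  grind

lemma seg_nodup (F : H.IsCycleFrame w P C U I nx) {u : W} (hu : u ∈ U) : (I u).Nodup := by
  obtain ⟨u', hu', hne⟩ := F.exists_ne (u := u)
  obtain ⟨Y, Z, hr, -⟩ := F.decomp u hu u' hu' hne
  exact (List.nodup_append.1 (hr.nodup_iff.1 F.longest.nodup)).1

lemma seg_isChain (F : H.IsCycleFrame w P C U I nx) {u : W} (hu : u ∈ U) :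
    (I u).IsChain H.Adj := by
  obtain ⟨u', hu', hne⟩ := F.exists_ne (u := u)
  obtain ⟨Y, Z, hr, -⟩ := F.decomp u hu u' hu' hne
  exact (List.isChain_append.1 (F.longest.of_isRotated hr).closed.1).1

lemma seg_disjoint (F : H.IsCycleFrame w P C U I nx) {u u' : W} (hu : u ∈ U) (hu' : u' ∈ U)
    (hne : u ≠ u') {z : W} (hz : z ∈ I u) : z ∉ I u' := by
  obtain ⟨Y, Z, hr, -⟩ := F.decomp u hu u' hu' hne
  have hnd := hr.nodup_iff.1 F.longest.nodup
  simp only [List.nodup_append, List.mem_append] at hnd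
  grind

lemma not_adj (F : H.IsCycleFrame w P C U I nx) {x y : W} (hx : x ∈ C) (hyC : y ∉ C)
    (hyU : y ∉ U) : ¬ H.Adj x y := fun h => by
  rcases F.attach x hx y h with h | h <;> contradiction

lemma not_adj_seg (F : H.IsCycleFrame w P C U I nx) {u x y : W} (hx : x ∈ C) (hu : u ∈ U)
    (hy : y ∈ I u) : ¬ H.Adj x y :=
  F.not_adj hx (fun h => F.notMem_cycle y h (F.mem_cycle_of_mem_seg hu hy))
    (F.notMem_of_mem_seg u hu y hy)

lemma adj_segFirst (F : H.IsCycleFrame w P C U I nx) {u : W} (hu : u ∈ U) (h : I u ≠ []) :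
    H.Adj u (segFirst I u) := by
  obtain ⟨u', hu', hne⟩ := F.exists_ne (u := u)
  obtain ⟨Y, Z, hr, -, -, -, h₂⟩ := F.decomp u hu u' hu' hne
  have hc := (F.longest.closed.of_isRotated hr).2
  refine hc u ?_ _ ?_
  · simp [List.getLast?_append, h₂]
  · simp [List.head?_append, head?_eq_segFirst h]

lemma adj_segLast (F : H.IsCycleFrame w P C U I nx) {u : W} (hu : u ∈ U) (h : I u ≠ []) :
    H.Adj (segLast I u) (nx u) := by
  obtain ⟨u', hu', hne⟩ := F.exists_ne (u := u)
  obtain ⟨Y, Z, hr, h₁, -⟩ := F.decomp u hu u' hu' hne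
  have hc := (List.isChain_append.1 (F.longest.closed.of_isRotated hr).1).2.2
  refine hc _ (getLast?_eq_segLast h) _ ?_
  simp [List.head?_append, h₁]

lemma le_length (F : H.IsCycleFrame w P C U I nx) {ℓ : ℕ} (hL : H.IsLinked C U ℓ) {u : W}
    (hu : u ∈ U) : ℓ ≤ (I u).length := by
  obtain ⟨u', hu', hne⟩ := F.exists_ne (u := u)
  obtain ⟨Y, Z, hr, h₁, h₂, h₃, h₄⟩ := F.decomp u hu u' hu' hne
  obtain ⟨d, d', hd, hd', hD⟩ := hL u hu (nx u) (F.nx_mem u hu) (F.nx_ne hu).symm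
  refine F.longest.le_of_bypass hr (F.notMem_seg hu F.apex_mem) (z₁ := nx u) (z₂ := u)
    (by simp [List.head?_append, h₁]) (by simp [List.getLast?_append, h₄]) ?_ hD hd hd'
  intro x hx hxZ
  exact F.notMem_cycle x hx (hr.mem_iff.2 (List.mem_append_right _ hxZ))

/-- The exchange along an edge `ab` between two segments, where `nx u` and `nx u'` are the ends of
the segments at which they are entered from outside. -/
lemma exchange_nx (F : H.IsCycleFrame w P C U I nx) {ℓ : ℕ} (hL : H.IsLinked C U ℓ) {u u' : W}
    (hu : u ∈ U) (hu' : u' ∈ U) (hne : u ≠ u') {m n : ℕ} {p a b q : W} (hp : H.Adj (nx u) p)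
    (hI : H.HasRoute {x | x ∈ I u} m p a) (hab : H.Adj a b)
    (hJ : H.HasRoute {x | x ∈ I u'} n b q) (hq : H.Adj q (nx u')) :
    m + n + ℓ ≤ (I u).length + (I u').length := by
  obtain ⟨Y, Z, hr, h₁, h₂, h₃, h₄⟩ := F.decomp u hu u' hu' hne
  obtain ⟨d, d', hd, hd', hD⟩ := hL u hu u' hu' hne
  exact F.longest.exchange hr (F.notMem_seg hu F.apex_mem) (F.notMem_seg hu' F.apex_mem) h₁ h₂ h₃ h₄
    (fun x hx => F.notMem_cycle x hx) hI hJ hD hp hab hq hd hd'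

/-- The mirror image of `exchange_nx`: the two segments are entered from `u` and `u'`. -/
lemma exchange_self (F : H.IsCycleFrame w P C U I nx) {ℓ : ℕ} (hL : H.IsLinked C U ℓ) {u u' : W}
    (hu : u ∈ U) (hu' : u' ∈ U) (hne : u ≠ u') {m n : ℕ} {p a b q : W} (hp : H.Adj u p)
    (hI : H.HasRoute {x | x ∈ I u} m p a) (hab : H.Adj a b)
    (hJ : H.HasRoute {x | x ∈ I u'} n b q) (hq : H.Adj q u') :
    m + n + ℓ ≤ (I u).length + (I u').length := by
  obtain ⟨Y, Z, hr, h₁, h₂, h₃, h₄⟩ := F.decomp u hu u' hu' hne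
  obtain ⟨d, d', hd, hd', hD⟩ := hL (nx u) (F.nx_mem u hu) (nx u') (F.nx_mem u' hu')
    (F.nx_ne_nx hu hu' hne)
  have hP := F.longest.of_isRotated hr
  have hP' := hP.reverse
  have hr' : (I u ++ (Y ++ (I u' ++ Z))).reverse ~r
      (I u).reverse ++ (Z.reverse ++ ((I u').reverse ++ Y.reverse)) := by
    have := List.isRotated_append (l := Z.reverse ++ ((I u').reverse ++ Y.reverse))
      (l' := (I u).reverse)
    simpa using this
  have := hP'.exchange hr' (by simpa using F.notMem_seg hu F.apex_mem)
    (by simpa using F.notMem_seg hu' F.apex_mem) (y₁ := u) (y₂ := nx u') (z₁ := u') (z₂ := nx u)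
    (by simpa) (by simpa) (by simpa) (by simpa) (S := (C : Set W)) (ℓ := ℓ) (m := m) (n := n)
    (p := p) (a := a) (b := b) (q := q) (d := d) (d' := d') ?_ (by simpa) (by simpa) hD hp hab hq
    hd hd'
  · simpa using this
  · intro x hx hxP
    exact F.notMem_cycle x hx (hr.mem_iff.2 (List.mem_reverse.1 hxP))

lemma hasRoute_seg (F : H.IsCycleFrame w P C U I nx) {u : W} (hu : u ∈ U) (h : I u ≠ []) :
    H.HasRoute {x | x ∈ I u} (I u).length (segFirst I u) (segLast I u) :=
  ⟨I u, F.seg_nodup hu, F.seg_isChain hu, head?_eq_segFirst h, getLast?_eq_segLast h,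
    fun _ hx => hx, le_rfl⟩

lemma seg_ne_nil (F : H.IsCycleFrame w P C U I nx) {ℓ : ℕ} (hL : H.IsLinked C U ℓ) (hℓ : 1 ≤ ℓ)
    {u : W} (hu : u ∈ U) : I u ≠ [] :=
  List.length_pos_iff.1 (hℓ.trans (F.le_length hL hu))

/-- Among the first `c` vertices of a segment none is adjacent to the first vertex of another
segment if vertices of `U` can be linked through `c` vertices of `C`. -/
lemma not_adj_segFirst (F : H.IsCycleFrame w P C U I nx) {c : ℕ} (hL : H.IsLinked C U c)
    (hc : 1 ≤ c) {u u' : W} (hu : u ∈ U) (hu' : u' ∈ U) (hne : u ≠ u') {a : W}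
    (ha : a ∈ (I u).take c) : ¬ H.Adj a (segFirst I u') := fun hadj => by
  have h₁ := F.seg_ne_nil hL hc hu
  have h₂ := F.seg_ne_nil hL hc hu'
  have h₃ := F.le_length hL hu
  have := F.exchange_nx hL hu hu' hne (F.adj_segLast hu h₁).symm
    (hasRoute_of_mem_take (F.seg_nodup hu) (F.seg_isChain hu) ha (getLast?_eq_segLast h₁)).symm hadj
    (F.hasRoute_seg hu' h₂) (F.adj_segLast hu' h₂)
  omega

lemma not_adj_segLast (F : H.IsCycleFrame w P C U I nx) {c : ℕ} (hL : H.IsLinked C U c)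
    (hc : 1 ≤ c) {u u' : W} (hu : u ∈ U) (hu' : u' ∈ U) (hne : u ≠ u') {a : W}
    (ha : a ∈ (I u).reverse.take c) : ¬ H.Adj a (segLast I u') := fun hadj => by
  have h₁ := F.seg_ne_nil hL hc hu
  have h₂ := F.seg_ne_nil hL hc hu'
  have h₃ := F.le_length hL hu
  have hch : (I u).reverse.IsChain H.Adj := by
    rw [List.isChain_reverse]
    exact (F.seg_isChain hu).imp fun _ _ h => h.symm
  have hR := hasRoute_of_mem_take (by simpa using F.seg_nodup hu) hch ha
    (t := segFirst I u) (by simpa using head?_eq_segFirst h₁)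
  have := F.exchange_self hL hu hu' hne (F.adj_segFirst hu h₁)
    (by simpa using hR.symm) hadj
    (F.hasRoute_seg hu' h₂).symm (F.adj_segFirst hu' h₂).symm
  omega

lemma segFirst_mem_take (F : H.IsCycleFrame w P C U I nx) {c : ℕ} (hL : H.IsLinked C U c)
    (hc : 1 ≤ c) {u : W} (hu : u ∈ U) : segFirst I u ∈ (I u).take c := by
  have h₁ := F.seg_ne_nil hL hc hu
  refine List.mem_of_mem_head? (?_ : _ = some _)
  rw [List.head?_take, if_neg (by omega), head?_eq_segFirst h₁]

lemma segLast_mem_take (F : H.IsCycleFrame w P C U I nx) {c : ℕ} (hL : H.IsLinked C U c)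
    (hc : 1 ≤ c) {u : W} (hu : u ∈ U) : segLast I u ∈ (I u).reverse.take c := by
  have h₁ := F.seg_ne_nil hL hc hu
  refine List.mem_of_mem_head? (?_ : _ = some _)
  rw [List.head?_take, if_neg (by omega), List.head?_reverse, getLast?_eq_segLast h₁]

/-! ### Transversals -/

lemma injOn_transversal (F : H.IsCycleFrame w P C U I nx) {f : W → W}
    (hf : ∀ u ∈ U, f u ∈ I u) : Set.InjOn f (U : Set W) := by
  intro u hu u' hu' h
  by_contra hne
  exact F.seg_disjoint hu hu' hne (hf u hu) (h ▸ hf u' hu')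

/-- An independent transversal of the segments remains independent together with a vertex of `C`. -/
lemma isIndepSet_transversal [DecidableEq W] (F : H.IsCycleFrame w P C U I nx) {f : W → W}
    (hf : ∀ u ∈ U, f u ∈ I u) (hfi : ∀ u ∈ U, ∀ u' ∈ U, u ≠ u' → ¬ H.Adj (f u) (f u')) {x : W}
    (hx : x ∈ C) :
    H.IsIndepSet (insert x (U.image f) : Finset W) ∧ (insert x (U.image f)).card = U.card + 1 := by
  have hxf : ∀ u ∈ U, x ≠ f u := fun u hu h =>
    F.notMem_cycle x hx (F.mem_cycle_of_mem_seg hu (h ▸ hf u hu))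
  constructor
  · rw [Finset.coe_insert, Finset.coe_image]
    have : Std.Symm (fun a b => ¬ H.Adj a b) := ⟨fun _ _ h h' => h h'.symm⟩
    rw [IsIndepSet, Set.pairwise_insert_of_symm]
    refine ⟨?_, ?_⟩
    · rintro _ ⟨u, hu, rfl⟩ _ ⟨u', hu', rfl⟩ hne
      exact hfi u hu u' hu' fun h => hne (by rw [h])
    · rintro _ ⟨u, hu, rfl⟩ -
      exact F.not_adj_seg hx hu (hf u hu)
  · rw [Finset.card_insert_of_notMem, Finset.card_image_of_injOn (F.injOn_transversal hf)]
    simpa using fun u hu => (hxf u hu).symm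

/-- If `U` has `α(H) - 1` elements, then an independent transversal of the segments and a vertex of
`C` form a maximal independent set. -/
lemma adj_of_transversal (F : H.IsCycleFrame w P C U I nx) {K : ℕ} (hU : K ≤ U.card)
    (hα : ∀ A : Finset W, H.IsIndepSet (A : Set W) → A.card ≤ K + 1) {f : W → W}
    (hf : ∀ u ∈ U, f u ∈ I u) (hfi : ∀ u ∈ U, ∀ u' ∈ U, u ≠ u' → ¬ H.Adj (f u) (f u')) {x z : W}
    (hx : x ∈ C) (hzx : z ≠ x) (hz : ∀ u ∈ U, z ≠ f u) :
    H.Adj z x ∨ ∃ u ∈ U, H.Adj z (f u) := by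
  classical
  by_contra! hcon
  obtain ⟨h₁, h₂⟩ := F.isIndepSet_transversal hf hfi hx
  have := hα (insert z (insert x (U.image f))) ?_
  · rw [Finset.card_insert_of_notMem] at this
    · omega
    · simp only [Finset.mem_insert, Finset.mem_image, not_or, not_exists, not_and]
      exact ⟨hzx, fun u hu => (hz u hu).symm⟩
  · have : Std.Symm (fun a b => ¬ H.Adj a b) := ⟨fun _ _ h h' => h h'.symm⟩
    rw [Finset.coe_insert, IsIndepSet, Set.pairwise_insert_of_symm]
    refine ⟨h₁, fun y hy _ => ?_⟩
    simp only [Finset.coe_insert, Finset.coe_image] at hy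
    rcases hy with rfl | ⟨u, hu, rfl⟩
    · exact hcon.1
    · exact hcon.2 u hu

/-- Two vertices of a segment are adjacent if an independent transversal of the other segments
avoids the neighbours of both. -/
lemma adj_of_partial_transversal (F : H.IsCycleFrame w P C U I nx) {K : ℕ} (hU : K ≤ U.card)
    (hα : ∀ A : Finset W, H.IsIndepSet (A : Set W) → A.card ≤ K + 1) (hC : C.Nonempty) {u : W}
    (hu : u ∈ U) {f : W → W} (hf : ∀ v ∈ U, v ≠ u → f v ∈ I v)
    (hfi : ∀ v ∈ U, v ≠ u → ∀ v' ∈ U, v' ≠ u → v ≠ v' → ¬ H.Adj (f v) (f v')) {a a' : W}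
    (ha : a ∈ I u) (ha' : a' ∈ I u) (haf : ∀ v ∈ U, v ≠ u → ¬ H.Adj a (f v))
    (haf' : ∀ v ∈ U, v ≠ u → ¬ H.Adj a' (f v)) (hne : a ≠ a') : H.Adj a a' := by
  classical
  obtain ⟨x, hx⟩ := hC
  have := F.adj_of_transversal hU hα (f := Function.update f u a') (x := x) (z := a) ?_ ?_ hx ?_ ?_
  · rcases this with h | ⟨v, hv, h⟩
    · exact absurd h.symm (F.not_adj_seg hx hu ha)
    · by_cases hvu : v = u
      · subst hvu
        simpa using h
      · rw [Function.update_of_ne hvu] at h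
        exact absurd h (haf v hv hvu)
  · intro v hv
    by_cases hvu : v = u
    · subst hvu
      simpa
    · rw [Function.update_of_ne hvu]
      exact hf v hv hvu
  · intro v hv v' hv' hvv'
    by_cases hvu : v = u
    · subst hvu
      rw [Function.update_self, Function.update_of_ne hvv'.symm]
      exact haf' v' hv' hvv'.symm
    · rw [Function.update_of_ne hvu]
      by_cases hvu' : v' = u
      · subst hvu'
        rw [Function.update_self]
        exact fun h => haf' v hv hvu h.symm
      · rw [Function.update_of_ne hvu']
        exact hfi v hv hvu v' hv' hvu' hvv'
  · rintro rfl
    exact F.notMem_cycle _ hx (F.mem_cycle_of_mem_seg hu ha)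
  · intro v hv
    by_cases hvu : v = u
    · subst hvu
      simpa using hne
    · rw [Function.update_of_ne hvu]
      rintro rfl
      exact F.seg_disjoint hv hu hvu (hf v hv hvu) ha

/-- The first `c` vertices of a segment form a clique. -/
lemma adj_of_mem_take (F : H.IsCycleFrame w P C U I nx) {K : ℕ} (hU : K ≤ U.card)
    (hα : ∀ A : Finset W, H.IsIndepSet (A : Set W) → A.card ≤ K + 1) (hC : C.Nonempty) {c : ℕ}
    (hL : H.IsLinked C U c) (hc : 1 ≤ c) {u : W} (hu : u ∈ U) {a a' : W}
    (ha : a ∈ (I u).take c) (ha' : a' ∈ (I u).take c) (hne : a ≠ a') : H.Adj a a' := by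
  refine F.adj_of_partial_transversal hU hα hC hu (f := segFirst I) ?_ ?_
    (List.mem_of_mem_take ha) (List.mem_of_mem_take ha') ?_ ?_ hne
  · exact fun v hv _ => segFirst_mem (F.seg_ne_nil hL hc hv)
  · exact fun v hv _ v' hv' _ h => F.not_adj_segFirst hL hc hv hv' h (F.segFirst_mem_take hL hc hv)
  · exact fun v hv h => F.not_adj_segFirst hL hc hu hv h.symm ha
  · exact fun v hv h => F.not_adj_segFirst hL hc hu hv h.symm ha'

/-- The last `c` vertices of a segment form a clique. -/
lemma adj_of_mem_reverse_take (F : H.IsCycleFrame w P C U I nx) {K : ℕ} (hU : K ≤ U.card)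
    (hα : ∀ A : Finset W, H.IsIndepSet (A : Set W) → A.card ≤ K + 1) (hC : C.Nonempty) {c : ℕ}
    (hL : H.IsLinked C U c) (hc : 1 ≤ c) {u : W} (hu : u ∈ U) {a a' : W}
    (ha : a ∈ (I u).reverse.take c) (ha' : a' ∈ (I u).reverse.take c) (hne : a ≠ a') :
    H.Adj a a' := by
  refine F.adj_of_partial_transversal hU hα hC hu (f := segLast I) ?_ ?_
    (by simpa using List.mem_of_mem_take ha) (by simpa using List.mem_of_mem_take ha') ?_ ?_ hne
  · exact fun v hv _ => segLast_mem (F.seg_ne_nil hL hc hv)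
  · exact fun v hv _ v' hv' _ h => F.not_adj_segLast hL hc hv hv' h (F.segLast_mem_take hL hc hv)
  · exact fun v hv h => F.not_adj_segLast hL hc hu hv h.symm ha
  · exact fun v hv h => F.not_adj_segLast hL hc hu hv h.symm ha'

/-! ### The segments are cliques -/

lemma hasRoute_segFirst (F : H.IsCycleFrame w P C U I nx) {K : ℕ} (hU : K ≤ U.card)
    (hα : ∀ A : Finset W, H.IsIndepSet (A : Set W) → A.card ≤ K + 1) (hC : C.Nonempty) {c : ℕ}
    (hL : H.IsLinked C U c) (hc : 1 ≤ c) {u : W} (hu : u ∈ U) {a : W} (ha : a ∈ (I u).take c)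
    (hne : a ≠ segFirst I u) : H.HasRoute {x | x ∈ I u} c (segFirst I u) a := by
  classical
  have hclique : H.IsClique (((I u).take c).toFinset : Set W) := by
    intro x hx y hy hxy
    exact F.adj_of_mem_take hU hα hC hL hc hu (by simpa using hx) (by simpa using hy) hxy
  have hcard : ((I u).take c).toFinset.card = c := by
    rw [List.toFinset_card_of_nodup ((F.seg_nodup hu).sublist (List.take_sublist c _)),
      List.length_take, min_eq_left (F.le_length hL hu)]
  refine (hclique.hasRoute (by simpa using F.segFirst_mem_take hL hc hu) (by simpa using ha)
    hne.symm).mono (fun x hx => ?_) hcard.ge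
  exact List.mem_of_mem_take (List.mem_toFinset.1 hx)

lemma hasRoute_segLast (F : H.IsCycleFrame w P C U I nx) {K : ℕ} (hU : K ≤ U.card)
    (hα : ∀ A : Finset W, H.IsIndepSet (A : Set W) → A.card ≤ K + 1) (hC : C.Nonempty) {c : ℕ}
    (hL : H.IsLinked C U c) (hc : 1 ≤ c) {u : W} (hu : u ∈ U) {a : W}
    (ha : a ∈ (I u).reverse.take c) (hne : a ≠ segLast I u) :
    H.HasRoute {x | x ∈ I u} c (segLast I u) a := by
  classical
  have hclique : H.IsClique (((I u).reverse.take c).toFinset : Set W) := by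
    intro x hx y hy hxy
    exact F.adj_of_mem_reverse_take hU hα hC hL hc hu (by simpa using hx) (by simpa using hy) hxy
  have hcard : ((I u).reverse.take c).toFinset.card = c := by
    rw [List.toFinset_card_of_nodup
      ((List.nodup_reverse.2 (F.seg_nodup hu)).sublist (List.take_sublist c _)),
      List.length_take, List.length_reverse, min_eq_left (F.le_length hL hu)]
  refine (hclique.hasRoute (by simpa using F.segLast_mem_take hL hc hu) (by simpa using ha)
    hne.symm).mono (fun x hx => ?_) hcard.ge
  exact List.mem_reverse.1 (List.mem_of_mem_take (List.mem_toFinset.1 hx))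

/-- A segment with fewer than `2 * c` vertices has two consecutive vertices in the middle, each of
which is joined to both ends by routes with at least `c` vertices. -/
lemma exists_middle (F : H.IsCycleFrame w P C U I nx) {K : ℕ} (hU : K ≤ U.card)
    (hα : ∀ A : Finset W, H.IsIndepSet (A : Set W) → A.card ≤ K + 1) (hC : C.Nonempty) {c e : ℕ}
    (hL : H.IsLinked C U c) (he : 1 ≤ e) (hc : e + 3 ≤ c) {u : W} (hu : u ∈ U)
    (hlen : (I u).length ≤ c + e) :
    ∃ A B m m', I u = A ++ m :: m' :: B ∧
      (H.HasRoute {x | x ∈ I u} c (segFirst I u) m ∧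
        H.HasRoute {x | x ∈ I u} c (segLast I u) m) ∧
      (H.HasRoute {x | x ∈ I u} c (segFirst I u) m' ∧
        H.HasRoute {x | x ∈ I u} c (segLast I u) m') := by
  have hlen' := F.le_length hL hu
  have hc1 : 1 ≤ c := by omega
  have hne := F.seg_ne_nil hL hc1 hu
  have hnd := F.seg_nodup hu
  -- The vertices at positions `e` and `e + 1` are inner vertices of the segment, and lie both among
  -- its first `c` and among its last `c` vertices.
  obtain ⟨A, l, hAl, hA⟩ : ∃ A l, I u = A ++ l ∧ A.length = e :=
    ⟨(I u).take e, (I u).drop e, (List.take_append_drop e _).symm, by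
      rw [List.length_take]; omega⟩
  have hl := congrArg List.length hAl
  rw [List.length_append] at hl
  rcases l with _ | ⟨m, _ | ⟨m', B⟩⟩
  · simp at hl; omega
  · simp at hl; omega
  simp only [List.length_cons] at hl
  have htake : (I u).take c = A ++ m :: m' :: B.take (c - e - 2) := by
    obtain ⟨j, rfl⟩ : ∃ j, c = e + (j + 2) := ⟨c - e - 2, by omega⟩
    rw [hAl, List.take_append, List.take_of_length_le (by omega), hA]
    simp
  have hrtake : (I u).reverse.take c =
      B.reverse ++ m' :: m :: A.reverse.take (c - B.length - 2) := by
    obtain ⟨j, rfl⟩ : ∃ j, c = B.length + (j + 2) := ⟨c - B.length - 2, by omega⟩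
    rw [hAl]
    have : (A ++ m :: m' :: B).reverse = B.reverse ++ (m' :: m :: A.reverse) := by simp
    rw [this, List.take_append, List.take_of_length_le (by simp), List.length_reverse]
    simp
  have hf : segFirst I u ∈ A := by
    rcases A with _ | ⟨a, A⟩
    · simp at hA; omega
    · simp [segFirst, hAl]
  have hb : segLast I u ∈ B := by
    refine List.mem_of_mem_getLast? (?_ : _ = some _)
    have hB : B ≠ [] := by
      rintro rfl
      simp at hl
      omega
    have := getLast?_eq_segLast hne
    rw [← this, hAl, List.getLast?_append, List.getLast?_cons_cons, List.getLast?_cons,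
      List.getLast?_eq_some_getLast hB]
    simp
  rw [hAl] at hnd
  simp only [List.nodup_append, List.nodup_cons, List.mem_cons] at hnd
  refine ⟨A, B, m, m', hAl, ⟨?_, ?_⟩, ?_, ?_⟩
  · exact F.hasRoute_segFirst hU hα hC hL hc1 hu (by simp [htake]) (by grind)
  · exact F.hasRoute_segLast hU hα hC hL hc1 hu (by simp [hrtake]) (by grind)
  · exact F.hasRoute_segFirst hU hα hC hL hc1 hu (by simp [htake]) (by grind)
  · exact F.hasRoute_segLast hU hα hC hL hc1 hu (by simp [hrtake]) (by grind)

/-- In a segment with at most `2 * c` vertices every vertex is joined to one of the ends by a route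
with at least `c` vertices. -/
lemma hasRoute_end (F : H.IsCycleFrame w P C U I nx) {K : ℕ} (hU : K ≤ U.card)
    (hα : ∀ A : Finset W, H.IsIndepSet (A : Set W) → A.card ≤ K + 1) (hC : C.Nonempty) {c : ℕ}
    (hL : H.IsLinked C U c) (hc : 1 ≤ c) {u : W} (hu : u ∈ U) (hlen : (I u).length ≤ c + c) {a : W}
    (ha : a ∈ I u) :
    H.HasRoute {x | x ∈ I u} c (segFirst I u) a ∨ H.HasRoute {x | x ∈ I u} c (segLast I u) a := by
  have hne := F.seg_ne_nil hL hc hu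
  have hfull := (F.hasRoute_seg hu hne).mono subset_rfl (F.le_length hL hu)
  have hmem : a ∈ (I u).take c ∨ a ∈ (I u).reverse.take c := by
    rw [← List.take_append_drop c (I u), List.mem_append] at ha
    refine ha.imp_right fun h => ?_
    rw [List.take_reverse, List.mem_reverse]
    refine (List.drop_sublist_drop_left _ (?_ : (I u).length - c ≤ c)).subset h
    omega
  rcases hmem with h | h
  · by_cases hs : a = segFirst I u
    · exact Or.inr (hs ▸ hfull.symm)
    · exact Or.inl (F.hasRoute_segFirst hU hα hC hL hc hu h hs)
  · by_cases hs : a = segLast I u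
    · exact Or.inl (hs ▸ hfull)
    · exact Or.inr (F.hasRoute_segLast hU hα hC hL hc hu h hs)

/-- A vertex `m` with long routes to both ends of its segment has no neighbour in another segment:
whichever end of that segment the neighbour can be reached from, one of the two exchanges
applies. -/
lemma not_adj_middle (F : H.IsCycleFrame w P C U I nx) {K : ℕ} (hU : K ≤ U.card)
    (hα : ∀ A : Finset W, H.IsIndepSet (A : Set W) → A.card ≤ K + 1) (hC : C.Nonempty) {c : ℕ}
    (hL : H.IsLinked C U c) (hc : 1 ≤ c) {u u' : W} (hu : u ∈ U) (hu' : u' ∈ U) (hne : u ≠ u')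
    (hlen : (I u).length + (I u').length < 3 * c) {a m : W} (ha : a ∈ I u)
    (hm : H.HasRoute {x | x ∈ I u'} c (segFirst I u') m)
    (hm' : H.HasRoute {x | x ∈ I u'} c (segLast I u') m) : ¬ H.Adj a m := fun hadj => by
  have h₁ := F.seg_ne_nil hL hc hu
  have h₂ := F.seg_ne_nil hL hc hu'
  have h₃ := F.le_length hL hu'
  rcases F.hasRoute_end hU hα hC hL hc hu (by omega) ha with h | h
  · have := F.exchange_self hL hu hu' hne (F.adj_segFirst hu h₁) h hadj hm.symm
      (F.adj_segFirst hu' h₂).symm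
    omega
  · have := F.exchange_nx hL hu hu' hne (F.adj_segLast hu h₁).symm h hadj hm'.symm
      (F.adj_segLast hu' h₂)
    omega

lemma length_le (F : H.IsCycleFrame w P C U I nx) {c e : ℕ} (hL : H.IsLinked C U c)
    (hlen : ∀ u ∈ U, ∀ u' ∈ U, u ≠ u' → (I u).length + (I u').length ≤ 2 * c + e) {u : W}
    (hu : u ∈ U) : (I u).length ≤ c + e := by
  obtain ⟨u', hu', hne⟩ := F.exists_ne (u := u)
  have := hlen u hu u' hu' hne
  have := F.le_length hL hu'
  omega

/-- Each segment is a clique, because vertices in the middle of the other segments form an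
independent set without neighbours in it. -/
lemma adj_of_mem_seg (F : H.IsCycleFrame w P C U I nx) {K : ℕ} (hU : K ≤ U.card)
    (hα : ∀ A : Finset W, H.IsIndepSet (A : Set W) → A.card ≤ K + 1) (hC : C.Nonempty) {c e : ℕ}
    (hL : H.IsLinked C U c) (he : 1 ≤ e) (hc : e + 3 ≤ c)
    (hlen : ∀ u ∈ U, ∀ u' ∈ U, u ≠ u' → (I u).length + (I u').length ≤ 2 * c + e) {u : W}
    (hu : u ∈ U) {a a' : W} (ha : a ∈ I u) (ha' : a' ∈ I u) (hne : a ≠ a') : H.Adj a a' := by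
  have hmid : ∀ v, ∃ m, v ∈ U → m ∈ I v ∧ H.HasRoute {x | x ∈ I v} c (segFirst I v) m ∧
      H.HasRoute {x | x ∈ I v} c (segLast I v) m := by
    intro v
    by_cases hv : v ∈ U
    · obtain ⟨A, B, m, m', hI, hm, -⟩ :=
        F.exists_middle hU hα hC hL he hc hv (F.length_le hL hlen hv)
      exact ⟨m, fun _ => ⟨by simp [hI], hm⟩⟩
    · exact ⟨v, fun h => absurd h hv⟩
  choose f hf using hmid
  have key : ∀ v ∈ U, ∀ v' ∈ U, v ≠ v' → ∀ b ∈ I v, ¬ H.Adj b (f v') := by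
    intro v hv v' hv' hvv' b hb
    have := hlen v hv v' hv' hvv'
    exact F.not_adj_middle hU hα hC hL (by omega) hv hv' hvv' (by omega) hb (hf v' hv').2.1
      (hf v' hv').2.2
  exact F.adj_of_partial_transversal hU hα hC hu (f := f) (fun v hv _ => (hf v hv).1)
    (fun v hv _ v' hv' _ h => key v hv v' hv' h _ (hf v hv).1) ha ha'
    (fun v hv h => key u hu v hv h.symm a ha) (fun v hv h => key u hu v hv h.symm a' ha') hne

/-- Every vertex off the cycle lies in `C`: any other one is adjacent to two consecutive vertices
of a segment, between which it could be inserted. -/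
lemma mem_of_notMem_cycle (F : H.IsCycleFrame w P C U I nx) {K : ℕ} (hU : K ≤ U.card)
    (hα : ∀ A : Finset W, H.IsIndepSet (A : Set W) → A.card ≤ K + 1) (hC : C.Nonempty) {c e : ℕ}
    (hL : H.IsLinked C U c) (he : 1 ≤ e) (hc : e + 3 ≤ c)
    (hlen : ∀ u ∈ U, ∀ u' ∈ U, u ≠ u' → (I u).length + (I u').length ≤ 2 * c + e) {y : W}
    (hy : y ∉ P) : y ∈ C := by
  by_contra hyC
  have hmid : ∀ v, ∃ m, v ∈ U → m ∈ I v ∧ (H.HasRoute {x | x ∈ I v} c (segFirst I v) m ∧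
      H.HasRoute {x | x ∈ I v} c (segLast I v) m) ∧ ¬ H.Adj y m := by
    intro v
    by_cases hv : v ∈ U
    · obtain ⟨A, B, m, m', hI, hm, hm'⟩ :=
        F.exists_middle hU hα hC hL he hc hv (F.length_le hL hlen hv)
      by_cases h₁ : H.Adj y m
      · by_cases h₂ : H.Adj y m'
        · exfalso
          obtain ⟨u', hu', hne⟩ := F.exists_ne (u := v)
          obtain ⟨Y, Z, hr, -⟩ := F.decomp v hv u' hu' hne
          have hr' : P ~r [] ++ (m' :: (B ++ (Y ++ (I u' ++ Z)) ++ (A ++ [m]))) := by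
            refine hr.trans ?_
            have := List.isRotated_append (l := A ++ [m]) (l' := m' :: (B ++ (Y ++ (I u' ++ Z))))
            rw [hI]
            simpa using this
          have := F.longest.le_of_bypass hr' (by simp) (z₁ := m') (z₂ := m) (by simp)
            (by simp [List.getLast?_cons]) (S := {x | x ∉ P}) ?_
            (hasRoute_singleton (p := y) hy) h₁.symm h₂
          · simp at this
          · intro x hx hxZ
            exact hx (hr'.mem_iff.2 hxZ)
        · exact ⟨m', fun _ => ⟨by simp [hI], hm', h₂⟩⟩
      · exact ⟨m, fun _ => ⟨by simp [hI], hm, h₁⟩⟩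
    · exact ⟨v, fun h => absurd h hv⟩
  choose f hf using hmid
  obtain ⟨x, hx⟩ := hC
  have := F.adj_of_transversal hU hα (f := f) (x := x) (z := y) (fun v hv => (hf v hv).1)
    ?_ hx ?_ ?_
  · rcases this with h | ⟨u, hu, h⟩
    · exact F.not_adj hx hyC (fun h => hy (F.mem_cycle y h)) h.symm
    · exact (hf u hu).2.2 h
  · intro v hv v' hv' hvv'
    have := hlen v hv v' hv' hvv'
    exact F.not_adj_middle hU hα ⟨x, hx⟩ hL (by omega) hv hv' hvv' (by omega) (hf v hv).1
      (hf v' hv').2.1.1 (hf v' hv').2.1.2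
  · rintro rfl
    exact hyC hx
  · rintro u hu rfl
    exact hy (F.mem_cycle_of_mem_seg hu (hf u hu).1)

/-! ### Edges between segments -/

lemma hasRoute_of_clique (F : H.IsCycleFrame w P C U I nx) {u : W} (hu : u ∈ U)
    (hcl : ∀ a ∈ I u, ∀ a' ∈ I u, a ≠ a' → H.Adj a a') {a a' : W} (ha : a ∈ I u) (ha' : a' ∈ I u)
    (hne : a ≠ a') : H.HasRoute {x | x ∈ I u} (I u).length a a' := by
  classical
  have hclique : H.IsClique ((I u).toFinset : Set W) := by
    intro x hx y hy hxy
    exact hcl x (by simpa using hx) y (by simpa using hy) hxy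
  refine (hclique.hasRoute (by simpa using ha) (by simpa using ha') hne).mono (fun x hx => ?_) ?_
  · exact List.mem_toFinset.1 hx
  · rw [List.toFinset_card_of_nodup (F.seg_nodup hu)]

/-- If the segments are cliques, then an edge between two of them joins the last vertex of one to
the first vertex of the other. -/
lemma ends_of_adj (F : H.IsCycleFrame w P C U I nx) {c : ℕ} (hL : H.IsLinked C U c) (hc : 2 ≤ c)
    (hcl : ∀ u ∈ U, ∀ a ∈ I u, ∀ a' ∈ I u, a ≠ a' → H.Adj a a') {u u' : W} (hu : u ∈ U)
    (hu' : u' ∈ U) (hne : u ≠ u') {a b : W} (ha : a ∈ I u) (hb : b ∈ I u') (hab : H.Adj a b) :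
    (a = segLast I u ∧ b = segFirst I u') ∨ (a = segFirst I u ∧ b = segLast I u') := by
  have hn := F.seg_ne_nil hL (by omega) hu
  have hn' := F.seg_ne_nil hL (by omega) hu'
  have h₁ : a = segLast I u ∨ b = segLast I u' := by
    by_contra! h
    have := F.exchange_nx hL hu hu' hne (F.adj_segLast hu hn).symm
      (F.hasRoute_of_clique hu (hcl u hu) (segLast_mem hn) ha h.1.symm) hab
      (F.hasRoute_of_clique hu' (hcl u' hu') hb (segLast_mem hn') h.2) (F.adj_segLast hu' hn')
    omega
  have h₂ : a = segFirst I u ∨ b = segFirst I u' := by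
    by_contra! h
    have := F.exchange_self hL hu hu' hne (F.adj_segFirst hu hn)
      (F.hasRoute_of_clique hu (hcl u hu) (segFirst_mem hn) ha h.1.symm) hab
      (F.hasRoute_of_clique hu' (hcl u' hu') hb (segFirst_mem hn') h.2)
      (F.adj_segFirst hu' hn').symm
    omega
  have h₃ := segFirst_ne_segLast (F.seg_nodup hu) (hc.trans (F.le_length hL hu))
  have h₄ := segFirst_ne_segLast (F.seg_nodup hu') (hc.trans (F.le_length hL hu'))
  grind

/-- If the last vertex of the clique `I u` is adjacent to the first vertex of the clique `I u'`,
then both segments have more than `c` vertices. Moreover, that vertex is the only neighbour of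
`nx u` in `I u`, respectively of `u'` in `I u'`. -/
lemma of_segLast_adj_segFirst (F : H.IsCycleFrame w P C U I nx) {c : ℕ} (hL : H.IsLinked C U c)
    (hc : 2 ≤ c) (hcl : ∀ u ∈ U, ∀ a ∈ I u, ∀ a' ∈ I u, a ≠ a' → H.Adj a a') {u u' : W}
    (hu : u ∈ U) (hu' : u' ∈ U) (hne : u ≠ u') (hab : H.Adj (segLast I u) (segFirst I u')) :
    (c + 1 ≤ (I u).length ∧ ∀ q ∈ I u, H.Adj (nx u) q → q = segLast I u) ∧
      (c + 1 ≤ (I u').length ∧ ∀ q ∈ I u', H.Adj u' q → q = segFirst I u') := by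
  have hn := F.seg_ne_nil hL (by omega) hu
  have hn' := F.seg_ne_nil hL (by omega) hu'
  have hfull := F.hasRoute_seg hu hn
  have hfull' := F.hasRoute_seg hu' hn'
  refine ⟨⟨?_, fun q hq hadj => ?_⟩, ?_, fun q hq hadj => ?_⟩
  · have := F.exchange_nx hL hu hu' hne (F.adj_segLast hu hn).symm
      (hasRoute_singleton (S := {x | x ∈ I u}) (segLast_mem hn)) hab hfull' (F.adj_segLast hu' hn')
    omega
  · by_contra hql
    have := F.exchange_nx hL hu hu' hne hadj
      (F.hasRoute_of_clique hu (hcl u hu) hq (segLast_mem hn) hql) hab hfull'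
      (F.adj_segLast hu' hn')
    omega
  · have := F.exchange_self hL hu hu' hne (F.adj_segFirst hu hn) hfull hab
      (hasRoute_singleton (S := {x | x ∈ I u'}) (segFirst_mem hn')) (F.adj_segFirst hu' hn').symm
    omega
  · by_contra hql
    have := F.exchange_self hL hu hu' hne (F.adj_segFirst hu hn) hfull hab
      (F.hasRoute_of_clique hu' (hcl u' hu') hq (segFirst_mem hn') hql).symm hadj.symm
    omega

end IsCycleFrame

/-- Every set of vertices that separates two nonempty parts of `H` has at least `K` elements: if
all neighbours of `A` lie in `A ∪ N`, and neither `A` nor the complement of `A` is contained in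
`N`, then `N` has at least `K` elements. -/
def SeparatorsAtLeast (H : SimpleGraph W) (K : ℕ) : Prop :=
  ∀ A N : Finset W, ∀ a ∈ A, a ∉ N → ∀ z, z ∉ A → z ∉ N →
    (∀ x ∈ A, ∀ y, H.Adj x y → y ∈ A ∨ y ∈ N) → K ≤ N.card

namespace IsCycleFrame

variable {H : SimpleGraph W} {w : W} {P : List W} {C U : Finset W} {I : W → List W} {nx : W → W}

/-! ### Cores of segments -/

open Classical in
/-- The vertices of the segment of `u` without neighbours in other segments. -/
noncomputable def core (H : SimpleGraph W) (U : Finset W) (I : W → List W) (u : W) : Finset W :=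
  (I u).toFinset.filter fun a => ∀ u' ∈ U, u ≠ u' → ∀ b ∈ I u', ¬ H.Adj a b

lemma mem_core {u a : W} :
    a ∈ core H U I u ↔ a ∈ I u ∧ ∀ u' ∈ U, u ≠ u' → ∀ b ∈ I u', ¬ H.Adj a b := by
  simp [core]

/-- Outside the core of a segment there can be only its first and its last vertex. If such an end is
outside, then the segment has more than `c` vertices, and the member of `U` next to that end has no
other neighbour in the segment. -/
lemma of_notMem_core (F : H.IsCycleFrame w P C U I nx) {c : ℕ} (hL : H.IsLinked C U c)
    (hc : 2 ≤ c) (hcl : ∀ u ∈ U, ∀ a ∈ I u, ∀ a' ∈ I u, a ≠ a' → H.Adj a a') {u : W}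
    (hu : u ∈ U) {a : W} (ha : a ∈ I u) (haC : a ∉ core H U I u) :
    c + 1 ≤ (I u).length ∧
      ((a = segFirst I u ∧ ∀ q ∈ I u, H.Adj u q → q = a) ∨
        (a = segLast I u ∧ ∀ q ∈ I u, H.Adj (nx u) q → q = a)) := by
  rw [mem_core] at haC
  push Not at haC
  obtain ⟨u', hu', hne, b, hb, hab⟩ := haC ha
  rcases F.ends_of_adj hL hc hcl hu hu' hne ha hb hab with ⟨rfl, rfl⟩ | ⟨rfl, rfl⟩
  · have h := (F.of_segLast_adj_segFirst hL hc hcl hu hu' hne hab).1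
    exact ⟨h.1, Or.inr ⟨rfl, h.2⟩⟩
  · have h := (F.of_segLast_adj_segFirst hL hc hcl hu' hu hne.symm hab.symm).2
    exact ⟨h.1, Or.inl ⟨rfl, h.2⟩⟩

/-- A segment with more than `c` vertices loses at most both ends, any other one loses nothing. -/
lemma le_card_core (F : H.IsCycleFrame w P C U I nx) {c : ℕ} (hL : H.IsLinked C U c)
    (hc : 2 ≤ c) (hcl : ∀ u ∈ U, ∀ a ∈ I u, ∀ a' ∈ I u, a ≠ a' → H.Adj a a') {u : W}
    (hu : u ∈ U) : c ≤ (core H U I u).card + 1 := by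
  classical
  have hcard := List.toFinset_card_of_nodup (F.seg_nodup hu)
  by_cases h : ∀ a ∈ I u, a ∈ core H U I u
  · have : (I u).toFinset ⊆ core H U I u := fun a ha => h a (by simpa using ha)
    have := Finset.card_le_card this
    have := F.le_length hL hu
    omega
  · push Not at h
    obtain ⟨a, ha, haC⟩ := h
    have h₁ := (F.of_notMem_core hL hc hcl hu ha haC).1
    have : (I u).toFinset ⊆ core H U I u ∪ {segFirst I u, segLast I u} := by
      intro b hb
      by_cases hbC : b ∈ core H U I u
      · exact Finset.mem_union_left _ hbC
      · have := (F.of_notMem_core hL hc hcl hu (by simpa using hb) hbC).2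
        simp
        tauto
    have h₂ := (Finset.card_le_card this).trans (Finset.card_union_le _ _)
    have h₃ := Finset.card_le_two (a := segFirst I u) (b := segLast I u)
    omega

/-- Every vertex of `U` has neighbours in all segments: otherwise the core of a segment is
separated from `C` by fewer than `|U|` vertices, since every end of the segment outside the core
makes the member of `U` next to it superfluous in the separator. -/
lemma exists_adj_seg (F : H.IsCycleFrame w P C U I nx) (hK : H.SeparatorsAtLeast U.card)
    (hC : C.Nonempty) {c : ℕ} (hL : H.IsLinked C U c) (hc : 2 ≤ c)
    (hcl : ∀ u ∈ U, ∀ a ∈ I u, ∀ a' ∈ I u, a ≠ a' → H.Adj a a') (hcov : ∀ y, y ∉ P → y ∈ C)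
    {u z : W} (hu : u ∈ U) (hz : z ∈ U) : ∃ y ∈ I u, H.Adj z y := by
  classical
  by_contra! hcon
  obtain ⟨x, hx⟩ := hC
  have hn := F.seg_ne_nil hL (by omega) hu
  have hfl := segFirst_ne_segLast (F.seg_nodup hu) (hc.trans (F.le_length hL hu))
  set E := (I u).toFinset \ core H U I u with hE
  have hEmem : ∀ a, a ∈ E ↔ a ∈ I u ∧ a ∉ core H U I u := by simp [hE]
  have hEspec : ∀ a ∈ E, (a = segFirst I u ∧ ∀ q ∈ I u, H.Adj u q → q = a) ∨
      (a = segLast I u ∧ ∀ q ∈ I u, H.Adj (nx u) q → q = a) := fun a ha =>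
    (F.of_notMem_core hL hc hcl hu ((hEmem a).1 ha).1 ((hEmem a).1 ha).2).2
  -- `g` sends an end of the segment to the member of `U` next to it. The separator consists of `E`
  -- and those members of `U` with a neighbour in the core, which excludes `z` and the image of `E`.
  set g : W → W := fun a => if a = segFirst I u then u else nx u with hg
  have hg₁ : g (segFirst I u) = u := by simp [hg]
  have hg₂ : g (segLast I u) = nx u := by simp [hg, hfl.symm]
  set N := U.filter fun v => ∃ y ∈ core H U I u, H.Adj v y with hN
  have hinj : Set.InjOn g (E : Set W) := by
    intro a ha b hb hab
    have hnx := F.nx_ne hu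
    rcases hEspec a ha with ⟨rfl, -⟩ | ⟨rfl, -⟩ <;> rcases hEspec b hb with ⟨rfl, -⟩ | ⟨rfl, -⟩
    · rfl
    · rw [hg₁, hg₂] at hab
      exact absurd hab.symm hnx
    · rw [hg₁, hg₂] at hab
      exact absurd hab hnx
    · rfl
  have hsub : N ∪ E.image g ⊆ U.erase z := by
    intro v hv
    rw [Finset.mem_union, hN, Finset.mem_filter, Finset.mem_image] at hv
    rw [Finset.mem_erase]
    rcases hv with ⟨hv, y, hy, hvy⟩ | ⟨a, ha, rfl⟩
    · refine ⟨?_, hv⟩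
      rintro rfl
      exact hcon y (mem_core.1 hy).1 hvy
    · rcases hEspec a ha with ⟨rfl, -⟩ | ⟨rfl, -⟩
      · rw [hg₁]
        refine ⟨?_, hu⟩
        rintro rfl
        exact hcon _ (segFirst_mem hn) (F.adj_segFirst hu hn)
      · rw [hg₂]
        refine ⟨?_, F.nx_mem u hu⟩
        rintro rfl
        exact hcon _ (segLast_mem hn) (F.adj_segLast hu hn).symm
  have hdisj : Disjoint N (E.image g) := by
    rw [Finset.disjoint_left]
    intro v hv hv'
    rw [hN, Finset.mem_filter] at hv
    obtain ⟨-, y, hy, hvy⟩ := hv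
    obtain ⟨a, ha, rfl⟩ := Finset.mem_image.1 hv'
    have hya : y = a := by
      rcases hEspec a ha with ⟨h, hq⟩ | ⟨h, hq⟩
      · exact hq y (mem_core.1 hy).1 (by rwa [h, hg₁] at hvy)
      · exact hq y (mem_core.1 hy).1 (by rwa [h, hg₂] at hvy)
    exact ((hEmem a).1 ha).2 (hya ▸ hy)
  have hcard : (N ∪ E).card < U.card := by
    have h₁ := Finset.card_le_card hsub
    rw [Finset.card_union_of_disjoint hdisj, Finset.card_image_of_injOn hinj] at h₁
    have h₂ := Finset.card_erase_lt_of_mem hz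
    have h₃ := Finset.card_union_le N E
    omega
  have hcore : (core H U I u).Nonempty := by
    rw [← Finset.card_pos]
    have := F.le_card_core hL hc hcl hu
    omega
  obtain ⟨a, ha⟩ := hcore
  have hxI : x ∉ I u := fun h => F.notMem_cycle x hx (F.mem_cycle_of_mem_seg hu h)
  refine absurd (hK (core H U I u) (N ∪ E) a ha ?_ x ?_ ?_ ?_) (not_le.2 hcard)
  · rw [Finset.mem_union, hN, Finset.mem_filter, hEmem]
    rintro (⟨h, -⟩ | ⟨-, h⟩)
    · exact F.notMem_seg hu h (mem_core.1 ha).1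
    · exact h ha
  · exact fun h => hxI (mem_core.1 h).1
  · rw [Finset.mem_union, hN, Finset.mem_filter, hEmem]
    rintro (⟨h, -⟩ | ⟨h, -⟩)
    · exact F.notMem_cycle x hx (F.mem_cycle x h)
    · exact hxI h
  · intro b hb y hby
    rw [Finset.mem_union, hN, Finset.mem_filter, hEmem]
    by_cases hyP : y ∈ P
    · by_cases hyU : y ∈ U
      · exact Or.inr (Or.inl ⟨hyU, b, hb, hby.symm⟩)
      · obtain ⟨u', hu', hyu'⟩ := F.exists_mem_seg y hyP hyU
        by_cases huu' : u = u'
        · subst huu'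
          tauto
        · exact absurd hby ((mem_core.1 hb).2 u' hu' huu' y hyu')
    · exact absurd hby.symm (F.not_adj_seg (hcov y hyP) hu (mem_core.1 hb).1)

/-- A neighbour `z ∈ U` of `w` has at least `|C| + |U|` neighbours. Since independent sets have at
most `|U| + 1` elements, `z` is adjacent to all vertices of `C` or of the core of some segment; it
also has neighbours in `C` and in each segment, and `w` is one more. -/
lemma le_card_neighbors [Fintype W] [DecidableRel H.Adj] (F : H.IsCycleFrame w P C U I nx)
    (hK : H.SeparatorsAtLeast U.card)
    (hα : ∀ A : Finset W, H.IsIndepSet (A : Set W) → A.card ≤ U.card + 1) (hC : C.Nonempty)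
    (hL : H.IsLinked C U C.card) (hc : 2 ≤ C.card)
    (hcl : ∀ u ∈ U, ∀ a ∈ I u, ∀ a' ∈ I u, a ≠ a' → H.Adj a a') (hcov : ∀ y, y ∉ P → y ∈ C)
    {z : W} (hz : z ∈ U) (hzw : H.Adj z w) : C.card + U.card ≤ H.degree z := by
  classical
  have hnbr : ∀ u, ∃ y, u ∈ U → y ∈ I u ∧ H.Adj z y := fun u => by
    by_cases hu : u ∈ U
    · obtain ⟨y, hy⟩ := F.exists_adj_seg hK hC hL hc hcl hcov hu hz
      exact ⟨y, fun _ => hy⟩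
    · exact ⟨u, fun h => absurd h hu⟩
  choose g hg using hnbr
  obtain ⟨d, hdC, hzd⟩ : ∃ d ∈ C, H.Adj z d := by
    obtain ⟨u', hu', hne⟩ := F.exists_ne (u := z)
    obtain ⟨d, d', hd, -, D, -, -, hDh, -, hDC, -⟩ := hL z hz u' hu' hne
    exact ⟨d, hDC d (List.mem_of_mem_head? hDh), hd⟩
  have hCI : ∀ u ∈ U, ∀ y ∈ I u, y ∉ C := fun u hu y hy h =>
    F.notMem_cycle y h (F.mem_cycle_of_mem_seg hu hy)
  have hwC : w ∉ C := fun h => F.notMem_cycle w h (F.mem_cycle w F.apex_mem)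
  have hcases : (∀ x ∈ C, H.Adj z x) ∨ ∃ u ∈ U, ∀ y ∈ core H U I u, H.Adj z y := by
    by_contra! hcon
    obtain ⟨⟨x, hx, hzx⟩, hcon⟩ := hcon
    have : ∀ u, ∃ y, u ∈ U → y ∈ core H U I u ∧ ¬ H.Adj z y := fun u => by
      by_cases hu : u ∈ U
      · obtain ⟨y, hy⟩ := hcon u hu
        exact ⟨y, fun _ => hy⟩
      · exact ⟨u, fun h => absurd h hu⟩
    choose f hf using this
    have := F.adj_of_transversal le_rfl hα (f := f) (x := x) (z := z)
      (fun u hu => (mem_core.1 (hf u hu).1).1)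
      (fun u hu u' hu' hne => (mem_core.1 (hf u hu).1).2 u' hu' hne _
        (mem_core.1 (hf u' hu').1).1) hx ?_ ?_
    · rcases this with h | ⟨u, hu, h⟩
      · exact hzx h
      · exact (hf u hu).2 h
    · rintro rfl
      exact F.notMem_cycle _ hx (F.mem_cycle _ hz)
    · rintro u hu h
      exact F.notMem_seg hu hz (h ▸ (mem_core.1 (hf u hu).1).1)
  have hginj := F.injOn_transversal (fun u hu => (hg u hu).1)
  rw [← card_neighborFinset_eq_degree]
  rcases hcases with h | ⟨u, hu, h⟩
  · have hsub : C ∪ U.image g ⊆ H.neighborFinset z := by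
      intro y hy
      rw [mem_neighborFinset]
      rcases Finset.mem_union.1 hy with hy | hy
      · exact h y hy
      · obtain ⟨u, hu, rfl⟩ := Finset.mem_image.1 hy
        exact (hg u hu).2
    refine le_of_eq_of_le ?_ (Finset.card_le_card hsub)
    rw [Finset.card_union_of_disjoint, Finset.card_image_of_injOn hginj]
    rw [Finset.disjoint_right]
    intro y hy
    obtain ⟨u, hu, rfl⟩ := Finset.mem_image.1 hy
    exact hCI u hu _ (hg u hu).1
  · have hsub : insert w (insert d ((U.erase u).image g ∪ core H U I u)) ⊆ H.neighborFinset z := by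
      intro y hy
      rw [mem_neighborFinset]
      simp only [Finset.mem_insert, Finset.mem_union, Finset.mem_image, Finset.mem_erase] at hy
      rcases hy with rfl | rfl | ⟨v, ⟨-, hv⟩, rfl⟩ | hy
      · exact hzw
      · exact hzd
      · exact (hg v hv).2
      · exact h y hy
    refine le_trans ?_ (Finset.card_le_card hsub)
    have hI : ∀ y ∈ (U.erase u).image g ∪ core H U I u, ∃ v ∈ U, y ∈ I v := by
      intro y hy
      simp only [Finset.mem_union, Finset.mem_image, Finset.mem_erase] at hy
      rcases hy with ⟨v, ⟨-, hv⟩, rfl⟩ | hy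
      · exact ⟨v, hv, (hg v hv).1⟩
      · exact ⟨u, hu, (mem_core.1 hy).1⟩
    rw [Finset.card_insert_of_notMem, Finset.card_insert_of_notMem, Finset.card_union_of_disjoint,
      Finset.card_image_of_injOn (hginj.mono (by simp)), Finset.card_erase_of_mem hu]
    · have := F.le_card_core hL hc hcl hu
      have := Finset.card_pos.2 ⟨u, hu⟩
      omega
    · rw [Finset.disjoint_left]
      intro y hy hy'
      obtain ⟨v, hv, rfl⟩ := Finset.mem_image.1 hy
      rw [Finset.mem_erase] at hv
      exact F.seg_disjoint hv.2 hu hv.1 (hg v hv.2).1 (mem_core.1 hy').1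
    · intro hd
      obtain ⟨v, hv, hdv⟩ := hI d hd
      exact hCI v hv d hdv hdC
    · intro hw
      rcases Finset.mem_insert.1 hw with rfl | hw
      · exact hwC hdC
      · obtain ⟨v, hv, hwv⟩ := hI w hw
        exact F.notMem_seg hv F.apex_mem hwv

end IsCycleFrame

/-! ### The component off a longest cycle -/

lemma hasRoute_of_reachable {H : SimpleGraph W} {T : Set W} {x y : T}
    (h : (H.induce T).Reachable x y) :
    H.HasRoute {z | ∃ hz : z ∈ T, (H.induce T).Reachable x ⟨z, hz⟩} 1 x y := by
  classical
  obtain ⟨p, hp⟩ := h.exists_isPath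
  refine ⟨p.support.map Subtype.val, hp.support_nodup.map Subtype.val_injective,
    ?_, ?_, ?_, ?_, ?_⟩
  · rw [List.isChain_map]
    exact p.isChain_adj_support.imp fun _ _ h => h
  · rw [List.head?_map, List.head?_eq_some_head p.support_ne_nil, Walk.head_support]
    rfl
  · rw [List.getLast?_map, List.getLast?_eq_some_getLast p.support_ne_nil, Walk.getLast_support]
    rfl
  · intro z hz
    obtain ⟨z, hz', rfl⟩ := List.mem_map.1 hz
    exact ⟨z.2, (p.takeUntil z hz').reachable⟩
  · simp [Walk.length_support]

namespace IsCycleFrame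

variable {H : SimpleGraph W} {w : W} {P : List W} {C U : Finset W} {I : W → List W} {nx : W → W}

/-- If `C` is a clique, then any two vertices of `U` have distinct neighbours in `C`, so that they
are linked through all of `C`. -/
lemma isLinked_card (F : H.IsCycleFrame w P C U I nx) (hK : H.SeparatorsAtLeast U.card)
    (hcl : H.IsClique (C : Set W)) (hC : 2 ≤ C.card) (hUC : ∀ u ∈ U, ∃ x ∈ C, H.Adj x u) :
    H.IsLinked C U C.card := by
  classical
  intro u hu u' hu' hne
  obtain ⟨p, hp, q, hq, hup, huq, hpq⟩ :
      ∃ p ∈ C, ∃ q ∈ C, H.Adj u p ∧ H.Adj q u' ∧ p ≠ q := by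
    by_contra! hcon
    obtain ⟨x, hx, hxu⟩ := hUC u hu
    obtain ⟨x', hx', hxu'⟩ := hUC u' hu'
    obtain rfl := hcon x hx x' hx' hxu.symm hxu'
    obtain ⟨a, ha, hax⟩ := Finset.exists_mem_ne (by omega : 1 < C.card) x
    have hUx : ∀ v ∈ U, v ≠ x := fun v hv h =>
      F.notMem_cycle x hx (h ▸ F.mem_cycle v hv)
    have hUa : ∀ v ∈ U, v ∉ C := fun v hv h => F.notMem_cycle v h (F.mem_cycle v hv)
    have := hK (C.erase x) (insert x ((U.erase u).erase u')) a (by simp [ha, hax]) ?_ u ?_ ?_ ?_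
    · have h₁ := Finset.card_erase_add_one hu
      have h₂ := Finset.card_erase_add_one (Finset.mem_erase.2 ⟨hne.symm, hu'⟩)
      have h₃ := Finset.card_insert_le x ((U.erase u).erase u')
      omega
    · simp only [Finset.mem_insert, Finset.mem_erase, not_or]
      exact ⟨hax, fun h => hUa a h.2.2 ha⟩
    · exact fun h => hUa u hu (Finset.mem_of_mem_erase h)
    · simp [hUx u hu]
    · intro b hb y hby
      simp only [Finset.mem_insert, Finset.mem_erase] at hb ⊢
      by_cases hyx : y = x
      · exact Or.inr (Or.inl hyx)
      · rcases F.attach b hb.2 y hby with hy | hy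
        · exact Or.inl ⟨hyx, hy⟩
        · refine Or.inr (Or.inr ⟨?_, ?_, hy⟩)
          · rintro rfl
            exact hb.1 (hcon x hx b hb.2 hxu.symm hby).symm
          · rintro rfl
            exact hb.1 (hcon b hb.2 x hx hby.symm hxu')
  exact ⟨p, q, hup, huq, hcl.hasRoute hp hq hpq⟩

/-- If the vertices of `U` can be linked through `C`, then the first vertices of the segments are
independent, and so are they together with a vertex of `C`. -/
lemma card_add_one_le (F : H.IsCycleFrame w P C U I nx) {n : ℕ}
    (hα : ∀ A : Finset W, H.IsIndepSet (A : Set W) → A.card ≤ n) (hC : C.Nonempty)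
    (hL : H.IsLinked C U 1) : U.card + 1 ≤ n := by
  classical
  obtain ⟨x, hx⟩ := hC
  obtain ⟨h₁, h₂⟩ := F.isIndepSet_transversal (f := segFirst I)
    (fun _ hu => segFirst_mem (F.seg_ne_nil hL le_rfl hu))
    (fun _ hu _ hu' h => F.not_adj_segFirst hL le_rfl hu hu' h (F.segFirst_mem_take hL le_rfl hu))
    hx
  exact h₂ ▸ hα _ h₁

lemma adj_segFirst_of_notMem (F : H.IsCycleFrame w P C U I nx)
    (hα : ∀ A : Finset W, H.IsIndepSet (A : Set W) → A.card ≤ U.card + 1)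
    (hL : H.IsLinked C U 1) {x z : W} (hx : x ∈ C) (hzx : z ≠ x) (hzU : ∀ u ∈ U, z ≠ segFirst I u) :
    H.Adj z x ∨ ∃ u ∈ U, H.Adj z (segFirst I u) :=
  F.adj_of_transversal le_rfl hα
    (fun _ hu => segFirst_mem (F.seg_ne_nil hL le_rfl hu))
    (fun _ hu _ hu' h => F.not_adj_segFirst hL le_rfl hu hu' h (F.segFirst_mem_take hL le_rfl hu))
    hx hzx hzU

lemma isClique (F : H.IsCycleFrame w P C U I nx)
    (hα : ∀ A : Finset W, H.IsIndepSet (A : Set W) → A.card ≤ U.card + 1)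
    (hL : H.IsLinked C U 1) : H.IsClique (C : Set W) := by
  intro x hx y hy hxy
  have hne : ∀ u ∈ U, segFirst I u ∈ I u := fun u hu => segFirst_mem (F.seg_ne_nil hL le_rfl hu)
  have hxf : ∀ u ∈ U, x ≠ segFirst I u := by
    rintro u hu rfl
    exact F.notMem_cycle _ hx (F.mem_cycle_of_mem_seg hu (hne u hu))
  rcases F.adj_segFirst_of_notMem hα hL hy hxy hxf with h | ⟨u, hu, h⟩
  · exact h
  · exact absurd h (F.not_adj_seg hx hu (hne u hu))

/-- If the vertices other than `w` have degree at most `d`, then the order of the graph is bounded,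
because every vertex outside `C ∪ U` is equal or adjacent to the first vertex of a segment. -/
lemma card_le [Fintype W] [DecidableRel H.Adj] (F : H.IsCycleFrame w P C U I nx)
    (hα : ∀ A : Finset W, H.IsIndepSet (A : Set W) → A.card ≤ U.card + 1) (hC : C.Nonempty)
    (hL : H.IsLinked C U 1) (hw : ∀ y, y ≠ w → H.Adj w y) {d : ℕ}
    (hd : ∀ z, z ≠ w → H.degree z ≤ d) : Fintype.card W ≤ U.card + C.card + U.card * d := by
  classical
  obtain ⟨x, hx⟩ := hC
  have hsub : Finset.univ ⊆ U ∪ C ∪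
      U.biUnion fun u => (insert (segFirst I u) (H.neighborFinset (segFirst I u))).erase w := by
    intro z _
    simp only [Finset.mem_union, Finset.mem_biUnion, Finset.mem_erase, Finset.mem_insert,
      mem_neighborFinset]
    by_cases hzU : z ∈ U
    · exact Or.inl (Or.inl hzU)
    by_cases hzC : z ∈ C
    · exact Or.inl (Or.inr hzC)
    have hzw : z ≠ w := fun h => hzU (h ▸ F.apex_mem)
    refine Or.inr ?_
    by_contra! hcon
    have hzx : z ≠ x := by
      rintro rfl
      exact hzC hx
    rcases F.adj_segFirst_of_notMem hα hL hx hzx fun u hu => (hcon u hu hzw).1 with h | ⟨u, hu, h⟩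
    · exact F.not_adj hx hzC hzU h.symm
    · exact (hcon u hu hzw).2 h.symm
  have h₁ := Finset.card_le_card hsub
  rw [Finset.card_univ] at h₁
  refine h₁.trans ((Finset.card_union_le _ _).trans (add_le_add (Finset.card_union_le _ _) ?_))
  refine Finset.card_biUnion_le_card_mul _ _ _ fun u hu => ?_
  have hs := segFirst_mem (F.seg_ne_nil hL le_rfl hu)
  have hsw : segFirst I u ≠ w := fun h => F.notMem_seg hu F.apex_mem (h ▸ hs)
  have hmem : w ∈ insert (segFirst I u) (H.neighborFinset (segFirst I u)) :=
    Finset.mem_insert_of_mem (by simpa using (hw _ hsw).symm)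
  rw [Finset.card_erase_of_mem hmem]
  have := Finset.card_insert_le (segFirst I u) (H.neighborFinset (segFirst I u))
  rw [card_neighborFinset_eq_degree] at this
  have := hd _ hsw
  omega

lemma sum_length_le [Fintype W] (F : H.IsCycleFrame w P C U I nx) :
    U.card + C.card + ∑ u ∈ U, (I u).length ≤ Fintype.card W := by
  classical
  have h₁ : ∑ u ∈ U, (I u).length = (U.biUnion fun u => (I u).toFinset).card := by
    rw [Finset.card_biUnion]
    · exact Finset.sum_congr rfl fun u hu => (List.toFinset_card_of_nodup (F.seg_nodup hu)).symm
    · intro u hu u' hu' hne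
      rw [Function.onFun, Finset.disjoint_left]
      intro z hz hz'
      exact F.seg_disjoint hu hu' hne (by simpa using hz) (by simpa using hz')
  rw [h₁, ← Finset.card_union_of_disjoint, ← Finset.card_union_of_disjoint]
  · exact Finset.card_le_univ _
  · rw [Finset.disjoint_right]
    intro z hz hz'
    obtain ⟨u, hu, hz⟩ := Finset.mem_biUnion.1 hz
    rw [List.mem_toFinset] at hz
    rcases Finset.mem_union.1 hz' with h | h
    · exact F.notMem_seg hu h hz
    · exact F.notMem_cycle z h (F.mem_cycle_of_mem_seg hu hz)
  · rw [Finset.disjoint_left]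
    exact fun z hz hz' => F.notMem_cycle z hz' (F.mem_cycle z hz)

/-- Segments whose lengths add up to at most `|U| * c + e`, each of them being at least `c`, have pairwise at most `2 * c + e` vertices. -/
lemma length_add_length_le (F : H.IsCycleFrame w P C U I nx) {c e : ℕ} (hL : H.IsLinked C U c)
    (hsum : ∑ u ∈ U, (I u).length ≤ U.card * c + e) {u u' : W} (hu : u ∈ U) (hu' : u' ∈ U)
    (hne : u ≠ u') : (I u).length + (I u').length ≤ 2 * c + e := by
  classical
  have h₁ := Finset.add_sum_erase U (fun v => (I v).length) hu
  have hmem : u' ∈ U.erase u := Finset.mem_erase.2 ⟨hne.symm, hu'⟩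
  have h₂ := Finset.add_sum_erase (U.erase u) (fun v => (I v).length) hmem
  have h₃ := Finset.card_nsmul_le_sum ((U.erase u).erase u') (fun v => (I v).length) c
    fun v hv => F.le_length hL (Finset.mem_of_mem_erase (Finset.mem_of_mem_erase hv))
  have h₄ := Finset.card_erase_add_one hu
  have h₅ := Finset.card_erase_add_one hmem
  have h₆ : U.card * c = ((U.erase u).erase u').card * c + 2 * c := by
    rw [← h₄, ← h₅]
    ring
  simp only [smul_eq_mul] at h₃
  omega

end IsCycleFrame

/-- In a graph with a vertex `w` adjacent to all others, with bounds on its separators, independent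
sets and order, a vertex of maximum degree among those different from `w` lies on every longest
cycle through `w`. -/
theorem IsLongestCycleThrough.mem_of_degree_max [Fintype W] {H : SimpleGraph W} [DecidableRel H.Adj]
    {w v : W} {K : ℕ} (hK2 : 2 ≤ K) (hw : ∀ y, y ≠ w → H.Adj w y) (hK : H.SeparatorsAtLeast K)
    (hα : ∀ A : Finset W, H.IsIndepSet (A : Set W) → A.card ≤ K + 1)
    (hcard : (K - 1) * (K + 1) * (2 * K + 1) + 2 ≤ Fintype.card W) (hvw : v ≠ w)
    (hv : ∀ z, z ≠ w → H.degree z ≤ H.degree v) {P : List W} (hP : H.IsLongestCycleThrough w P) :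
    v ∈ P := by
  classical
  by_contra hvP
  set T : Set W := {x | x ∉ P} with hT
  -- `C` is the vertex set of the component of `v` in the graph without `P`.
  set C : Finset W :=
    Finset.univ.filter fun x => ∃ hx : x ∈ T, (H.induce T).Reachable ⟨v, hvP⟩ ⟨x, hx⟩ with hCdef
  have hCmem : ∀ x, x ∈ C ↔ ∃ hx : x ∈ T, (H.induce T).Reachable ⟨v, hvP⟩ ⟨x, hx⟩ := by
    simp [hCdef]
  have hvC : v ∈ C := (hCmem v).2 ⟨hvP, Reachable.refl _⟩
  have hCP : ∀ x ∈ C, x ∉ P := fun x hx => ((hCmem x).1 hx).1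
  have hCclosed : ∀ x ∈ C, ∀ y, H.Adj x y → y ∉ P → y ∈ C := by
    intro x hx y hxy hy
    obtain ⟨hxT, hr⟩ := (hCmem x).1 hx
    refine (hCmem y).2 ⟨hy, hr.trans (Adj.reachable ?_)⟩
    exact hxy
  have hroute : ∀ x ∈ C, ∀ y ∈ C, H.HasRoute (C : Set W) 1 x y := by
    intro x hx y hy
    obtain ⟨hxT, hrx⟩ := (hCmem x).1 hx
    obtain ⟨hyT, hry⟩ := (hCmem y).1 hy
    refine (hasRoute_of_reachable (hrx.symm.trans hry)).mono ?_ le_rfl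
    rintro z ⟨hz, hrz⟩
    exact (hCmem z).2 ⟨hz, hrx.trans hrz⟩
  set U : Finset W := P.toFinset.filter fun u => ∃ x ∈ C, H.Adj x u with hUdef
  have hUmem : ∀ u, u ∈ U ↔ u ∈ P ∧ ∃ x ∈ C, H.Adj x u := by simp [hUdef]
  have hwU : w ∈ U := (hUmem w).2 ⟨hP.mem, v, hvC, (hw v hvw).symm⟩
  have hattach : ∀ x ∈ C, ∀ y, H.Adj x y → y ∈ C ∨ y ∈ U := by
    intro x hx y hxy
    by_cases hy : y ∈ P
    · exact Or.inr ((hUmem y).2 ⟨hy, x, hx, hxy⟩)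
    · exact Or.inl (hCclosed x hx y hxy hy)
  -- The successor of `w` on `P` has no neighbour in `C`: a detour through such a neighbour would
  -- lengthen `P`, since `w` is adjacent to everything.
  obtain ⟨q, hqP, hqU⟩ : ∃ q ∈ P, q ∉ U := by
    obtain ⟨A, B, hAB⟩ := List.append_of_mem hP.mem
    have hr : P ~r w :: (B ++ A) := by
      rw [hAB]
      simpa using List.isRotated_append (l := A) (l' := w :: B)
    rcases hBA : B ++ A with _ | ⟨q, Q⟩
    · rw [hBA] at hr
      exact absurd ((hP.closed.of_isRotated hr).2 w rfl w rfl) (H.loopless.irrefl w)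
    · rw [hBA] at hr
      refine ⟨q, hr.mem_iff.2 (by simp), fun hq => ?_⟩
      obtain ⟨-, x, hx, hxq⟩ := (hUmem q).1 hq
      have hr' : P ~r [] ++ (q :: (Q ++ [w])) := by
        have := List.isRotated_append (l := [w]) (l' := q :: Q)
        exact hr.trans (by simpa using this)
      have hxw : x ≠ w := fun h => hCP x hx (h ▸ hP.mem)
      have := hP.le_of_bypass hr' (by simp) (z₁ := q) (z₂ := w) (by simp)
        (by simp [List.getLast?_cons]) (S := (C : Set W))
        (fun y hy hyZ => hCP y hy (hr'.mem_iff.2 hyZ)) (hasRoute_singleton (p := x) hx)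
        (hw x hxw) hxq
      simp at this
  have hKU : K ≤ U.card := by
    refine hK C U v hvC (fun h => hvP ((hUmem v).1 h).1) q (fun h => hCP q h hqP) hqU hattach
  obtain ⟨u₁, hu₁, u₂, hu₂, hu₁₂⟩ := Finset.one_lt_card.1 (by omega : 1 < U.card)
  obtain ⟨I, nx, hnx, hIU, hIP, hdec⟩ := exists_segments hP.nodup
    (fun u hu => ((hUmem u).1 hu).1) ⟨u₁, hu₁, u₂, hu₂, hu₁₂⟩
  have F : H.IsCycleFrame w P C U I nx :=
    ⟨hP, hwU, fun u hu => ((hUmem u).1 hu).1, hCP, hattach, ⟨u₁, hu₁, u₂, hu₂, hu₁₂⟩, hnx, hIU, hIP,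
      hdec⟩
  have hL₁ : H.IsLinked C U 1 := by
    intro u hu u' hu' _
    obtain ⟨-, x, hx, hxu⟩ := (hUmem u).1 hu
    obtain ⟨-, y, hy, hyu'⟩ := (hUmem u').1 hu'
    exact ⟨x, y, hxu.symm, hyu', hroute x hx y hy⟩
  have hUK : U.card = K := by
    have := F.card_add_one_le hα ⟨v, hvC⟩ hL₁
    omega
  subst hUK
  have hcl := F.isClique hα hL₁
  have hdegv : H.degree v + 1 ≤ C.card + U.card := by
    have hsub : H.neighborFinset v ⊆ C.erase v ∪ U := by
      intro y hy
      rw [mem_neighborFinset] at hy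
      rw [Finset.mem_union, Finset.mem_erase]
      exact (hattach v hvC y hy).imp_left fun h => ⟨hy.ne', h⟩
    have h₁ := (Finset.card_le_card hsub).trans (Finset.card_union_le _ _)
    rw [card_neighborFinset_eq_degree] at h₁
    have h₂ := Finset.card_erase_add_one hvC
    omega
  have hcount := F.card_le hα ⟨v, hvC⟩ hL₁ hw hv
  obtain ⟨k, hk⟩ : ∃ k, U.card = k + 2 := ⟨U.card - 2, by omega⟩
  -- The order of the graph makes `C` large compared with the excess `|U| * (|U| - 1)` of the
  -- segments over `|C|`.
  have hbound : U.card + C.card + U.card * H.degree v ≤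
      U.card + C.card + (U.card * C.card + U.card * (U.card - 1)) := by
    rw [← mul_add]
    have : H.degree v ≤ C.card + (U.card - 1) := by omega
    gcongr
  have hclarge : 2 * (U.card * (U.card - 1)) + 1 ≤ C.card := by
    have h := (hcard.trans hcount).trans hbound
    rw [hk] at h ⊢
    simp only [show k + 2 - 1 = k + 1 by omega] at h ⊢
    by_contra! hcon
    have : (k + 3) * C.card ≤ (k + 3) * (2 * ((k + 2) * (k + 1))) := by
      gcongr
      omega
    nlinarith
  have he : 2 ≤ U.card * (U.card - 1) := by
    calc 2 = 2 * 1 := rfl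
      _ ≤ U.card * (U.card - 1) := Nat.mul_le_mul (by omega) (by omega)
  have hL := F.isLinked_card hK hcl (by omega) (fun u hu => ((hUmem u).1 hu).2)
  have hlen : ∀ u ∈ U, ∀ u' ∈ U, u ≠ u' →
      (I u).length + (I u').length ≤ 2 * C.card + U.card * (U.card - 1) := by
    intro u hu u' hu' hne
    refine F.length_add_length_le hL ?_ hu hu' hne
    have := F.sum_length_le
    omega
  have hseg := fun u (hu : u ∈ U) a (ha : a ∈ I u) a' (ha' : a' ∈ I u) (hne : a ≠ a') =>
    F.adj_of_mem_seg le_rfl hα ⟨v, hvC⟩ hL (by omega) (by omega) hlen hu ha ha' hne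
  have hcov := fun y (hy : y ∉ P) =>
    F.mem_of_notMem_cycle le_rfl hα ⟨v, hvC⟩ hL (by omega) (by omega) hlen hy
  obtain ⟨z, hz, hzw⟩ := F.exists_ne (u := w)
  have h₁ := F.le_card_neighbors hK hα ⟨v, hvC⟩ hL (by omega) hseg hcov hz (hw z hzw.symm).symm
  have h₂ := hv z hzw.symm
  omega

variable {V : Type*}

/-! ### The cone over a graph -/

/-- The cone over `G`: the graph `G` with a new vertex `none` that is adjacent to all others. -/
def cone (G : SimpleGraph V) : SimpleGraph (Option V) where
  Adj
    | none, none => False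
    | none, some _ => True
    | some _, none => True
    | some a, some b => G.Adj a b
  symm := ⟨by
    rintro (_ | a) (_ | b) h
    · exact h
    · trivial
    · trivial
    · exact G.adj_symm h⟩
  loopless := ⟨by
    rintro (_ | a) h
    · exact h
    · exact G.loopless.irrefl a h⟩

@[simp] lemma cone_adj_some_some {G : SimpleGraph V} {a b : V} :
    G.cone.Adj (some a) (some b) ↔ G.Adj a b := Iff.rfl

@[simp] lemma cone_adj_none_some {G : SimpleGraph V} {a : V} : G.cone.Adj none (some a) := trivial

@[simp] lemma cone_adj_some_none {G : SimpleGraph V} {a : V} : G.cone.Adj (some a) none := trivial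

lemma cone_adj_none {G : SimpleGraph V} {y : Option V} (hy : y ≠ none) : G.cone.Adj none y := by
  cases y
  · exact absurd rfl hy
  · trivial

lemma degree_cone_some [Fintype V] {G : SimpleGraph V} [DecidableRel G.Adj]
    [DecidableRel G.cone.Adj] (a : V) : G.cone.degree (some a) = G.degree a + 1 := by
  classical
  have : G.cone.neighborFinset (some a) =
      insert none ((G.neighborFinset a).map Function.Embedding.some) := by
    ext y
    rcases y with _ | y <;> simp
  rw [← card_neighborFinset_eq_degree, this, Finset.card_insert_of_notMem (by simp),
    Finset.card_map, card_neighborFinset_eq_degree]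

lemma card_le_of_isIndepSet_cone [Fintype V] {G : SimpleGraph V} {n : ℕ} (hn : 1 ≤ n)
    (hα : G.indepNum ≤ n) {A : Finset (Option V)} (hA : G.cone.IsIndepSet (A : Set (Option V))) :
    A.card ≤ n := by
  classical
  by_cases h : none ∈ A
  · have : A ⊆ {none} := by
      intro y hy
      by_contra hne
      rw [Finset.mem_singleton] at hne
      exact hA h hy (Ne.symm hne) (cone_adj_none hne)
    exact (Finset.card_le_card this).trans (by simpa using hn)
  · have hB : G.IsIndepSet (A.eraseNone : Set V) := by
      intro a ha b hb hab
      have := hA (by simpa using ha : some a ∈ (A : Set (Option V))) (by simpa using hb)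
        (by simpa using hab)
      simpa using this
    have h₁ := hB.card_le_indepNum
    rw [Finset.card_eraseNone_of_not_mem h] at h₁
    exact h₁.trans hα

lemma IsKVertexConnected.separatorsAtLeast_cone [Fintype V] {G : SimpleGraph V} {k : ℕ}
    (hG : G.IsKVertexConnected k) : G.cone.SeparatorsAtLeast (k + 1) := by
  classical
  intro A N a ha haN z hzA hzN hAN
  by_contra! hcard
  have hnA : none ∉ A := by
    intro h
    have hz : z ≠ none := fun h' => hzA (h' ▸ h)
    rcases hAN none h z (cone_adj_none hz) with h | h <;> contradiction
  have hnN : none ∈ N := by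
    have hane : a ≠ none := fun h' => hnA (h' ▸ ha)
    exact (hAN a ha none (cone_adj_none hane).symm).resolve_left hnA
  obtain ⟨a, rfl⟩ := Option.ne_none_iff_exists'.1 (fun h' => hnA (h' ▸ ha) : a ≠ none)
  obtain ⟨z, rfl⟩ := Option.ne_none_iff_exists'.1 (fun h' => hzN (h' ▸ hnN) : z ≠ none)
  have hS : N.eraseNone.card < k := by
    have := Finset.card_eraseNone_of_mem hnN
    have := Finset.card_pos.2 ⟨_, hnN⟩
    omega
  have hconn := hG.2 N.eraseNone hS
  obtain ⟨p⟩ := hconn.preconnected ⟨a, by simpa using haN⟩ ⟨z, by simpa using hzN⟩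
  -- Walks that avoid `N` cannot leave `A`.
  have key : ∀ (x y : ((N.eraseNone : Set V)ᶜ : Set V)), (G.induce _).Walk x y →
      some x.1 ∈ A → some y.1 ∈ A := by
    intro x y p
    induction p with
    | nil => exact id
    | @cons x y t hxy p ih =>
      intro hx
      refine ih ((hAN _ hx (some y.1) ?_).resolve_right ?_)
      · exact hxy
      · have := y.2
        simpa using this
  exact hzA (key _ _ p ha)

/-- The vertices of a path, together with the apex of the cone, form a cycle of the cone. -/
lemma Walk.IsLongestPath.isLongestCycleThrough {G : SimpleGraph V} {x y : V} {P : G.Walk x y}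
    (hP : P.IsLongestPath) :
    G.cone.IsLongestCycleThrough none (none :: P.support.map some) where
  mem := by simp
  nodup := by
    rw [List.nodup_cons]
    exact ⟨by simp, hP.1.support_nodup.map (Option.some_injective V)⟩
  closed := by
    refine ⟨?_, ?_⟩
    · rw [List.isChain_cons]
      refine ⟨?_, ?_⟩
      · rintro _ h
        obtain ⟨b, -, rfl⟩ := List.mem_map.1 (List.mem_of_mem_head? h)
        trivial
      · rw [List.isChain_map]
        exact P.isChain_adj_support
    · rintro a ha b hb
      obtain rfl : none = b := by simpa using hb
      rw [List.getLast?_cons, List.getLast?_map,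
        List.getLast?_eq_some_getLast P.support_ne_nil] at ha
      obtain rfl : _ = a := by simpa using ha
      trivial
  max Q hQ hnd hcl := by
    obtain ⟨A, B, rfl⟩ := List.append_of_mem hQ
    have hr : (A ++ none :: B) ~r (none :: (B ++ A)) := by
      simpa using List.isRotated_append (l := A) (l' := none :: B)
    rw [hr.perm.length_eq]
    have hnd' := hr.nodup_iff.1 hnd
    have hcl' := (hcl.of_isRotated hr).1
    rw [List.nodup_cons] at hnd'
    obtain ⟨L, hL⟩ : ∃ L : List V, L.map some = B ++ A := by
      have : ∀ l : List (Option V), none ∉ l → ∃ L : List V, L.map some = l := by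
        intro l hl
        induction l with
        | nil => exact ⟨[], rfl⟩
        | cons a l ih =>
          rcases a with _ | a
          · simp at hl
          · obtain ⟨L, hL⟩ := ih fun h => hl (List.mem_cons_of_mem _ h)
            exact ⟨a :: L, by simp [hL]⟩
      exact this _ hnd'.1
    rw [← hL] at hnd' hcl' ⊢
    have hch : L.IsChain G.Adj := by
      have := (List.isChain_cons.1 hcl').2
      rwa [List.isChain_map] at this
    have hLnd : L.Nodup := List.Nodup.of_map _ hnd'.2
    simp only [List.length_cons, List.length_map, Walk.length_support]
    by_cases hne : L = []
    · simp [hne]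
    · have hw := hP.2 _ _ (Walk.ofSupport L hne hch)
        (by rw [Walk.isPath_def, Walk.support_ofSupport]; exact hLnd)
      rw [Walk.length_ofSupport] at hw
      omega

end SimpleGraph

theorem mainTheorem1 (k : ℕ) (hk : 1 ≤ k) {V : Type*} [Fintype V]
    (G : SimpleGraph V) [DecidableRel G.Adj]
    (hn : k * (k + 2) * (2 * k + 3) + 1 ≤ Fintype.card V)
    (hconn : G.IsKVertexConnected k) (hα : G.indepNum ≤ k + 2)
    (v : V) (hv : G.degree v = G.maxDegree) :
    G.IsGallaiVertex v := by
  classical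
  intro x y P hP
  refine ⟨v, rfl, ?_⟩
  have h := hP.isLongestCycleThrough.mem_of_degree_max (v := some v) (K := k + 1) (by omega)
    (fun _ hy => SimpleGraph.cone_adj_none hy) hconn.separatorsAtLeast_cone
    (fun A hA => SimpleGraph.card_le_of_isIndepSet_cone (by omega) hα hA) ?_ (by simp) ?_
  · simpa using h
  · rw [Fintype.card_option]
    rw [Nat.add_sub_cancel, show k + 1 + 1 = k + 2 by ring,
      show 2 * (k + 1) + 1 = 2 * k + 3 by ring]
    omega
  · intro z hz
    obtain ⟨z, rfl⟩ := Option.ne_none_iff_exists'.1 hz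
    rw [SimpleGraph.degree_cone_some, SimpleGraph.degree_cone_some, hv]
    exact Nat.add_le_add_right (G.degree_le_maxDegree z) 1
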